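/- Let $R$ be a finite commutative local ring with residue field of cardinality $q$, let $u\ge 0$ be an integer, and let $\mu$ be a probability distribution on $R$ which is concentrated neither on a translate $b+I$ of a proper ideal $I\subsetneq R$ ($b\in R$), nor on a translate $b+wS$ of a unit multiple of a proper subring $S\subsetneq R$ ($b\in R$, $w\in R^\times$). For each $n$ let $\mathcal M_{n,n+u}$ be a random $n\times(n+u)$ matrix over $R$ with independent entries of law $\mu$, and let $\mathcal U_{n,n+u}$ be a random $n\times(n+u)$ matrix with independent, uniformly distributed entries in $R$. The cokernel of an $n\times m$ matrix over $R$ is the quotient of $R^n$ by the span of its columns. For a finite $R$-module $A$ let $d(A)\in\mathbb Z$ be the number of generators minus the number of relations in a minimal presentation of $A$ (for example $d(R^3)=3$). Then, for every finite $R$-module $A$, $$\lim_{n\to\infty}\mathbb P\big(\operatorname{coker}(\mathcal M_{n,n+u})\cong A\big)=\frac{1}{|A|^u\,|\mathrm{Aut}_R(A)|}\prod_{i\ge d(A)+u+1}\left(1-q^{-i}\right)=\lim_{n\to\infty}\mathbb P\big(\operatorname{coker}(\mathcal U_{n,n+u})\cong A\big).$$ Here $i$ runs over all integers $i\ge d(A)+u+1$;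 the product converges, and it is $0$ if $d(A)+u+1\le 0$, because of the factor at $i=0$. -/

import Mathlib

open MeasureTheory ProbabilityTheory Filter Topology

/-- The cokernel of an `n × m` matrix `M` over `R`: the quotient of `R^n` by the column span of `M`,
that is, by the image of `M : R^m → R^n`. -/
abbrev MatrixCokernel {R : Type*} [CommRing R] {n m : ℕ} (M : Matrix (Fin n) (Fin m) R) : Type _ :=
  (Fin n → R) ⧸ LinearMap.range M.mulVecLin

/-- `X` is a random `n × m` matrix, defined on the probability space `(Ω, P)`, whose entries are
independent and all have the law `μ`. -/
structure IsIIDMatrix {R : Type*} [MeasurableSpace R] {Ω : Type*} [MeasurableSpace Ω] {n m : ℕ}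
    (X : Ω → Matrix (Fin n) (Fin m) R) (μ : Measure R) (P : Measure Ω) : Prop where
  law : ∀ i j, HasLaw (fun ω => X ω i j) μ P
  indep : iIndepFun (fun (p : Fin n × Fin m) (ω : Ω) => X ω p.1 p.2) P

/-- The law `μ` on `R` is concentrated neither on a translate `b + I` of a proper ideal `I` of `R`
nor on a translate `b + w S` of a unit multiple of a proper subring `S` of `R`. -/
structure IsNondegenerateLaw {R : Type*} [CommRing R] [MeasurableSpace R] (μ : Measure R) :
    Prop where
  ideal : ∀ I : Ideal R, I ≠ ⊤ → ∀ b : R, ¬ ∀ᵐ x ∂μ, ∃ a ∈ I, x = b + a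
  subring : ∀ S : Subring R, S ≠ ⊤ → ∀ (w : Rˣ) (b : R), ¬ ∀ᵐ x ∂μ, ∃ s ∈ S, x = b + w * s

/-- `A` has a presentation `R^r → R^g → A → 0` with `g` generators and `r` relations. -/
def HasPresentation (R : Type*) [CommRing R] (A : Type*) [AddCommGroup A] [Module R A]
    (g r : ℕ) : Prop :=
  ∃ (φ : (Fin r → R) →ₗ[R] (Fin g → R)) (π : (Fin g → R) →ₗ[R] A),
    Function.Exact φ π ∧ Function.Surjective π

/-- The number of generators in a minimal presentation of a finitely presented module `A`. -/
noncomputable def minGenerators (R : Type*) [CommRing R] (A : Type*) [AddCommGroup A]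
    [Module R A] : ℕ :=
  sInf {g | ∃ r, HasPresentation R A g r}

/-- The number of relations in a minimal presentation of a finitely presented module `A`: the least
number of relations in a presentation with the least number of generators. -/
noncomputable def minRelations (R : Type*) [CommRing R] (A : Type*) [AddCommGroup A]
    [Module R A] : ℕ :=
  sInf {r | HasPresentation R A (minGenerators R A) r}

/-- `d(A)`: the number of generators minus the number of relations in a minimal presentation of `A`
(an integer, possibly negative; for instance `d(R^3) = 3`). -/
noncomputable def presentationDefect (R : Type*) [CommRing R] (A : Type*) [AddCommGroup A]
    [Module R A] : ℤ :=
  (minGenerators R A : ℤ) - (minRelations R A : ℤ)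

/-- The `k`-th factor `1 - q^{-i}`, `i = d(A) + u + 1 + k`, of the product over all integers
`i ≥ d(A) + u + 1`, where `q` is the cardinality of the residue field of `R`. -/
noncomputable def sawinWoodFactor (R : Type*) [CommRing R] [IsLocalRing R] (A : Type*)
    [AddCommGroup A] [Module R A] (u k : ℕ) : ℝ :=
  1 - (Nat.card (IsLocalRing.ResidueField R) : ℝ) ^ (-(presentationDefect R A + u + 1 + k))

/-- `|A|^{-u} |Aut_R A|^{-1} ∏_{i ≥ d(A) + u + 1} (1 - q^{-i})`. -/
noncomputable def sawinWoodValue (R : Type*) [CommRing R] [IsLocalRing R] (A : Type*)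
    [AddCommGroup A] [Module R A] (u : ℕ) : ℝ :=
  1 / ((Nat.card A : ℝ) ^ u * (Nat.card (A ≃ₗ[R] A) : ℝ)) * ∏' k : ℕ, sawinWoodFactor R A u k

/-! Let `v` be a family of `n` elements generating a finite module `B`. All columns satisfy the
relations of `v` with probability `relationProb m v ^ (n + u)`, and the sum over `v` is a surjection
moment of the cokernel. Expand `relationProb` over the characters of `B`. A character that separates
more than `δ n` entries contributes exponentially little. The remaining, light characters have a
common kernel `H`, and most entries of `v` lie in the subgroup `C` of elements that every difference
of support points multiplies into `H`. About `|C|^n` families do this, each with relation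
probability at most about `1/|H|`. The ideal condition gives a unit difference, hence `|C| ≤ |H|`.
If equality held with all entries in `C`, the subring condition would make `C` a submodule, so `C =
B = H`. When `H ≠ B`, a constant factor is therefore gained per column, either from `|C| < |H|` or
from a light character that separates an entry. So the moments converge to the uniform ones, even
with absolute errors summed over `v` (`tendsto_sum_abs_relationProb_sub`).

To pass from moments to probabilities, note that `coker M ≅ A` means that the column span `W` is the
relation module `K` of some generating family of `A`, and of exactly `|Aut A|` families
(`card_aut_mul_ite`). With `k` the residue field, `q = |k|` and `W ≤ K`, equality holds iff
`Hom(K/W, k)` has dimension zero. Alternating sums over linearly independent `j`-tuples of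
functionals bound this indicator from above and below in turn (`bonferroni_nonneg`). The common
kernel of such a tuple on `K` is the relation module of a generating family of one of finitely many
modules of order `|A| q^j`, so the summed error bound still applies (`sum_tupleKernel_le`). By
Schanuel's lemma `dim Hom(K, k) = n - d(A)`. Thus about `|A|^n` families with `q^{j(n - d(A))}`
tuples each, every one of probability about `(|A| q^j)^{-(n+u)}`, contribute `|A|^{-u}
q^{-j(d(A)+u)}` in the limit. Euler's series `∑ eulerCoeff q j * y^j = ∏_{i ≥ 1} (1 - y q^{-i})` at
`y = q^{-(d(A)+u)}` sums these to the product, whatever the sign of `d(A) + u`. -/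

/-- Weights of a probability distribution on a finite ring that is not concentrated on a translate
of a proper ideal or of a unit multiple of a proper subring. -/
structure IsNondegenerateWeight {R : Type*} [CommRing R] [Fintype R] (m : R → ℝ) : Prop where
  nonneg : ∀ x, 0 ≤ m x
  sum_eq_one : ∑ x, m x = 1
  ideal : ∀ I : Ideal R, I ≠ ⊤ → ∀ b : R, ∃ x, m x ≠ 0 ∧ x - b ∉ I
  subring : ∀ S : Subring R, S ≠ ⊤ → ∀ (w : Rˣ) (b : R), ∃ x, m x ≠ 0 ∧ ∀ s ∈ S, x ≠ b + w * s

/-! ### Fourier analysis of a single random relation -/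

section Fourier

variable {R : Type*} [CommRing R] [Fintype R] {m : R → ℝ}
  {B : Type*} [AddCommGroup B] [Module R B] [Finite B]

/-- The mean of `χ (r • b)` for `r` with weights `m`. -/
noncomputable def charMean (m : R → ℝ) (χ : AddChar B ℂ) (b : B) : ℂ := ∑ r, (m r : ℂ) * χ (r • b)

/-- The function `r ↦ χ (r • b)` is not constant on the support of `m`. -/
def Separates (m : R → ℝ) (χ : AddChar B ℂ) (b : B) : Prop :=
  ∃ x y, m x ≠ 0 ∧ m y ≠ 0 ∧ χ ((x - y) • b) ≠ 1

lemma norm_charMean_le_one (hm : IsNondegenerateWeight m) (χ : AddChar B ℂ) (b : B) :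
    ‖charMean m χ b‖ ≤ 1 := by
  refine (norm_sum_le _ _).trans ?_
  rw [← hm.sum_eq_one]
  refine Finset.sum_le_sum fun r _ => ?_
  simp [abs_of_nonneg (hm.nonneg r)]

/-- Strict convexity of the disc: a nontrivial average of distinct points on the unit circle lies
inside. -/
lemma norm_charMean_lt_one (hm : IsNondegenerateWeight m) {χ : AddChar B ℂ} {b : B}
    (h : Separates m χ b) : ‖charMean m χ b‖ < 1 := by
  obtain ⟨x, y, hx, hy, hxy⟩ := h
  have hne : χ (x • b) ≠ χ (y • b) := by
    intro h
    apply hxy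
    rw [sub_smul, AddChar.map_sub_eq_div, h, div_self]
    exact (AddChar.val_isUnit _ _).ne_zero
  have := norm_sum_lt_of_strictConvexSpace (t := Finset.univ) (w := m) (r := 1)
    (z := fun r => χ (r • b)) (i := x) (j := y) (fun i _ => hm.nonneg i) hm.sum_eq_one
    (Finset.mem_univ _) (Finset.mem_univ _) hne hx hy (fun i _ => by simp)
  simpa [charMean] using this

/-- A uniform bound below one for the character means that are not of modulus one. -/
lemma exists_norm_charMean_le (hm : IsNondegenerateWeight m) (B : Type*) [AddCommGroup B]
    [Module R B] [Finite B] :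
    ∃ θ : ℝ, 0 < θ ∧ θ < 1 ∧ ∀ (χ : AddChar B ℂ) (b : B), Separates m χ b →
      ‖charMean m χ b‖ ≤ θ := by
  classical
  have hfin : ({p : AddChar B ℂ × B | Separates m p.1 p.2}).Finite := Set.toFinite _
  by_cases hne : ({p : AddChar B ℂ × B | Separates m p.1 p.2}).Nonempty
  · obtain ⟨p, hp, hmax⟩ := hfin.exists_maximalFor (fun p => ‖charMean m p.1 p.2‖) _ hne
    have h1 := norm_charMean_lt_one hm hp
    refine ⟨max (1 / 2) ‖charMean m p.1 p.2‖, by positivity, by simp [h1]; norm_num,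
      fun χ b h => ?_⟩
    refine le_max_of_le_right ?_
    by_contra! hlt
    exact absurd (hmax (j := (χ, b)) h hlt.le) (not_le.2 hlt)
  · refine ⟨1 / 2, by norm_num, by norm_num, fun χ b h => ?_⟩
    exact absurd ⟨(χ, b), h⟩ hne

open Classical in
/-- The probability that `∑ i, x i • v i = 0` for independent `x i` with weights `m`. -/
noncomputable def relationProb (m : R → ℝ) {n : ℕ} (v : Fin n → B) : ℝ :=
  ∑ x : Fin n → R, (∏ i, m (x i)) * if ∑ i, x i • v i = 0 then 1 else 0

omit [Finite B] in
lemma relationProb_nonneg (hm : IsNondegenerateWeight m) {n : ℕ} (v : Fin n → B) :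
    0 ≤ relationProb m v := by
  refine Finset.sum_nonneg fun x _ => mul_nonneg (Finset.prod_nonneg fun i _ => hm.nonneg _) ?_
  split_ifs <;> norm_num

omit [Finite B] in
lemma addChar_map_sum {ι : Type*} (χ : AddChar B ℂ) (s : Finset ι) (f : ι → B) :
    χ (∑ i ∈ s, f i) = ∏ i ∈ s, χ (f i) := by
  classical
  induction s using Finset.induction_on with
  | empty => simp
  | insert i s hi ih => rw [Finset.sum_insert hi, Finset.prod_insert hi, AddChar.map_add_eq_mul, ih]

lemma relationProb_eq_sum (m : R → ℝ) {n : ℕ} [Fintype B] (v : Fin n → B) :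
    (relationProb m v : ℂ) = (∑ χ : AddChar B ℂ, ∏ i, charMean m χ (v i)) / Fintype.card B := by
  classical
  have h0 : (Fintype.card B : ℂ) ≠ 0 := Nat.cast_ne_zero.2 Fintype.card_ne_zero
  rw [eq_div_iff h0]
  have h1 : ∀ χ : AddChar B ℂ, ∏ i, charMean m χ (v i) =
      ∑ x : Fin n → R, (∏ i, (m (x i) : ℂ)) * χ (∑ i, x i • v i) := by
    intro χ
    simp only [charMean]
    rw [Finset.prod_univ_sum, Fintype.piFinset_univ]
    refine Finset.sum_congr rfl fun x _ => ?_
    rw [Finset.prod_mul_distrib, addChar_map_sum]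
  simp only [h1]
  rw [Finset.sum_comm, relationProb, Complex.ofReal_sum, Finset.sum_mul]
  refine Finset.sum_congr rfl fun x _ => ?_
  rw [← Finset.mul_sum, AddChar.sum_apply_eq_ite]
  split_ifs <;> simp

/-- Characters trivial on `H` are the characters of `B ⧸ H`. -/
lemma card_addChar_trivialOn [Fintype B] (H : AddSubgroup B) :
    Nat.card {χ : AddChar B ℂ // ∀ b ∈ H, χ b = 1} * Nat.card H = Nat.card B := by
  have e : {χ : AddChar B ℂ // ∀ b ∈ H, χ b = 1} ≃ AddChar (B ⧸ H) ℂ :=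
    { toFun := fun χ => AddChar.toAddMonoidHomEquiv.symm
        (QuotientAddGroup.lift H χ.1.toAddMonoidHom (fun b hb => χ.2 b hb))
      invFun := fun ψ => ⟨ψ.compAddMonoidHom (QuotientAddGroup.mk' H), fun b hb => by
        have : (QuotientAddGroup.mk' H) b = 0 := (QuotientAddGroup.eq_zero_iff b).2 hb
        rw [AddChar.compAddMonoidHom_apply, this, AddChar.map_zero_eq_one]⟩
      left_inv := fun χ => by
        apply Subtype.ext
        apply DFunLike.ext
        intro b
        rfl
      right_inv := fun ψ => by
        apply DFunLike.ext
        intro b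
        induction b using QuotientAddGroup.induction_on
        rfl }
  rw [Nat.card_congr e]
  have := Fintype.ofFinite (B ⧸ H)
  rw [Nat.card_eq_fintype_card, AddChar.card_eq, ← Nat.card_eq_fintype_card]
  exact H.card_eq_card_quotient_mul_card_addSubgroup.symm

end Fourier

/-! ### Light characters and the gain from nondegeneracy -/

section Dichotomy

variable {R : Type*} [CommRing R] [Fintype R] {m : R → ℝ}
  {B : Type*} [AddCommGroup B] [Module R B]

/-- The elements `b` that all differences of the support of `m` multiply into `H`. -/
def differenceColon (m : R → ℝ) (H : AddSubgroup B) : AddSubgroup B where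
  carrier := {b | ∀ x y, m x ≠ 0 → m y ≠ 0 → (x - y) • b ∈ H}
  zero_mem' := fun x y _ _ => by simp
  add_mem' := fun {a b} ha hb x y hx hy => by
    rw [smul_add]
    exact H.add_mem (ha x y hx hy) (hb x y hx hy)
  neg_mem' := fun {a} ha x y hx hy => by
    rw [smul_neg]
    exact H.neg_mem (ha x y hx hy)

lemma IsNondegenerateWeight.exists_support (hm : IsNondegenerateWeight m) : ∃ x, m x ≠ 0 := by
  by_contra! h
  have := hm.sum_eq_one
  simp [h] at this

lemma IsNondegenerateWeight.exists_unit_sub [IsLocalRing R] (hm : IsNondegenerateWeight m) :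
    ∃ (w : Rˣ) (x y : R), m x ≠ 0 ∧ m y ≠ 0 ∧ x - y = w := by
  obtain ⟨y, hy⟩ := hm.exists_support
  obtain ⟨x, hx, hxy⟩ := hm.ideal (IsLocalRing.maximalIdeal R)
    (IsLocalRing.maximalIdeal.isMaximal R).ne_top y
  have : IsUnit (x - y) := by simpa using hxy
  exact ⟨this.unit, x, y, hx, hy, rfl⟩

/-- Multiplication by a difference of support points that is a unit maps the colon subgroup
injectively into `H`. -/
lemma card_differenceColon_le [IsLocalRing R] [Finite B] (hm : IsNondegenerateWeight m)
    (H : AddSubgroup B) : Nat.card (differenceColon m H) ≤ Nat.card H := by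
  obtain ⟨w, x, y, hx, hy, hw⟩ := hm.exists_unit_sub
  refine Nat.card_le_card_of_injective
    (fun b => ⟨(w : R) • (b : B), hw ▸ b.2 x y hx hy⟩) ?_
  intro a b hab
  have h : (w : R) • (a : B) = (w : R) • (b : B) := congrArg Subtype.val hab
  apply Subtype.ext
  have := congrArg (fun z => ((w⁻¹ : Rˣ) : R) • z) h
  simpa [smul_smul] using this

/-- If the colon subgroup is as large as possible, it is stable under the ring. -/
lemma smul_mem_differenceColon [IsLocalRing R] [Finite B] (hm : IsNondegenerateWeight m)
    {H : AddSubgroup B} (hcard : Nat.card (differenceColon m H) = Nat.card H) (r : R) {b : B}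
    (hb : b ∈ differenceColon m H) : r • b ∈ differenceColon m H := by
  obtain ⟨w, x, y, hx, hy, hw⟩ := hm.exists_unit_sub
  let C := differenceColon m H
  let f : C → H := fun b => ⟨(w : R) • (b : B), hw ▸ b.2 x y hx hy⟩
  have hinj : Function.Injective f := by
    intro a b hab
    have h : (w : R) • (a : B) = (w : R) • (b : B) := congrArg Subtype.val hab
    apply Subtype.ext
    have := congrArg (fun z => ((w⁻¹ : Rˣ) : R) • z) h
    simpa [smul_smul] using this
  have hsurj : Function.Surjective f :=
    ((Nat.bijective_iff_injective_and_card f).2 ⟨hinj, hcard⟩).2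
  have hmem : ∀ h ∈ H, ((w⁻¹ : Rˣ) : R) • h ∈ C := by
    intro h hh
    obtain ⟨c, hc⟩ := hsurj ⟨h, hh⟩
    have hc' : (w : R) • (c : B) = h := congrArg Subtype.val hc
    rw [← hc', smul_smul]
    simp
  -- By equality of orders `w C = H`, so each `w⁻¹ (z - y)` with `z` in the support maps `C` into
  -- itself. The multipliers of `C` form a subring, and the support lies in its translate `y + w S`.
  let S : Subring R :=
    { carrier := {r | ∀ c ∈ C, r • c ∈ C}
      mul_mem' := fun {a b} ha hb c hc => by rw [mul_smul]; exact ha _ (hb _ hc)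
      one_mem' := fun c hc => by rwa [one_smul]
      add_mem' := fun {a b} ha hb c hc => by rw [add_smul]; exact C.add_mem (ha _ hc) (hb _ hc)
      zero_mem' := fun c hc => by rw [zero_smul]; exact C.zero_mem
      neg_mem' := fun {a} ha c hc => by rw [neg_smul]; exact C.neg_mem (ha _ hc) }
  have hS : S = ⊤ := by
    by_contra hS
    obtain ⟨z, hz, hzS⟩ := hm.subring S hS w y
    refine hzS (((w⁻¹ : Rˣ) : R) * (z - y)) (fun c hc => ?_) ?_
    · rw [mul_smul]
      exact hmem _ (hc z y hz hy)
    · rw [← mul_assoc]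
      simp
  have : r ∈ S := hS ▸ Subring.mem_top r
  exact this b hb

lemma card_differenceColon_lt [IsLocalRing R] [Finite B] (hm : IsNondegenerateWeight m)
    {H : AddSubgroup B} (hH : H ≠ ⊤) {n : ℕ} {v : Fin n → B}
    (hv : Submodule.span R (Set.range v) = ⊤) (hvC : ∀ i, v i ∈ differenceColon m H) :
    Nat.card (differenceColon m H) < Nat.card H := by
  refine lt_of_le_of_ne (card_differenceColon_le hm H) fun hcard => hH ?_
  let N : Submodule R B :=
    { differenceColon m H with
      smul_mem' := fun r b hb => smul_mem_differenceColon hm hcard r hb }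
  have hN : N = ⊤ := by
    rw [← top_le_iff, ← hv, Submodule.span_le]
    rintro _ ⟨i, rfl⟩
    exact hvC i
  have htop : differenceColon m H = ⊤ := by
    rw [AddSubgroup.eq_top_iff']
    intro b
    have : b ∈ N := hN ▸ Submodule.mem_top
    exact this
  rw [htop] at hcard
  exact (AddSubgroup.card_eq_iff_eq_top H).1 (by rw [← hcard]; simp)

open Classical in
/-- The characters that separate at most `δ n` of the entries of `v`. -/
def IsLight (m : R → ℝ) (δ : ℝ) {n : ℕ} (v : Fin n → B) (χ : AddChar B ℂ) : Prop :=
  ((Finset.univ.filter fun i => Separates m χ (v i)).card : ℝ) ≤ δ * n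

/-- The common kernel of the light characters. -/
def lightKernel (m : R → ℝ) (δ : ℝ) {n : ℕ} (v : Fin n → B) : AddSubgroup B where
  carrier := {b | ∀ χ : AddChar B ℂ, IsLight m δ v χ → χ b = 1}
  zero_mem' := fun χ _ => by simp
  add_mem' := fun {a b} ha hb χ hχ => by rw [AddChar.map_add_eq_mul, ha χ hχ, hb χ hχ, one_mul]
  neg_mem' := fun {a} ha χ hχ => by rw [AddChar.map_neg_eq_inv, ha χ hχ, inv_one]

omit [Fintype R] in
lemma exists_isLight_separates {δ : ℝ} {n : ℕ} {v : Fin n → B} {i : Fin n}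
    (hi : v i ∉ differenceColon m (lightKernel m δ v)) :
    ∃ χ, IsLight m δ v χ ∧ Separates m χ (v i) := by
  have : ¬ ∀ x y, m x ≠ 0 → m y ≠ 0 → (x - y) • v i ∈ lightKernel m δ v := hi
  push Not at this
  obtain ⟨x, y, hx, hy, hxy⟩ := this
  have : ¬ ∀ χ : AddChar B ℂ, IsLight m δ v χ → χ ((x - y) • v i) = 1 := hxy
  push Not at this
  obtain ⟨χ, hχ, h⟩ := this
  exact ⟨χ, hχ, x, y, hx, hy, h⟩

omit [Fintype R] in
open Classical in
-- An entry outside the colon subgroup is separated by some light character; there are at most `|B|`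
-- of these, each separating at most `δ n` entries.
lemma card_notMem_differenceColon_le [Finite B] {δ : ℝ} (hδ : 0 ≤ δ) {n : ℕ} (v : Fin n → B) :
    ((Finset.univ.filter fun i => v i ∉ differenceColon m (lightKernel m δ v)).card : ℝ) ≤
      Nat.card B * δ * n := by
  have := Fintype.ofFinite B
  have hsub : (Finset.univ.filter fun i => v i ∉ differenceColon m (lightKernel m δ v)) ⊆
      (Finset.univ.filter fun χ : AddChar B ℂ => IsLight m δ v χ).biUnion
        fun χ => Finset.univ.filter fun i => Separates m χ (v i) := by
    intro i hi
    obtain ⟨χ, hχ, hs⟩ := exists_isLight_separates (Finset.mem_filter.1 hi).2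
    simp only [Finset.mem_biUnion, Finset.mem_filter, Finset.mem_univ, true_and]
    exact ⟨χ, hχ, hs⟩
  calc _ ≤ ((∑ χ ∈ Finset.univ.filter fun χ : AddChar B ℂ => IsLight m δ v χ,
        (Finset.univ.filter fun i => Separates m χ (v i)).card : ℕ) : ℝ) :=
        Nat.cast_le.2 ((Finset.card_le_card hsub).trans Finset.card_biUnion_le)
    _ ≤ ∑ χ ∈ Finset.univ.filter fun χ : AddChar B ℂ => IsLight m δ v χ, δ * n := by
        rw [Nat.cast_sum]
        exact Finset.sum_le_sum fun χ hχ => (Finset.mem_filter.1 hχ).2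
    _ ≤ ∑ χ : AddChar B ℂ, δ * n :=
        Finset.sum_le_sum_of_subset_of_nonneg (Finset.filter_subset _ _)
          fun _ _ _ => by positivity
    _ = Nat.card B * δ * n := by
        rw [Finset.sum_const, Finset.card_univ, AddChar.card_eq, nsmul_eq_mul,
          Nat.card_eq_fintype_card, mul_assoc]

variable [Finite B] {θ δ : ℝ} {n : ℕ} {v : Fin n → B}

lemma prod_norm_charMean_le_pow (hm : IsNondegenerateWeight m) (hθ0 : 0 < θ) (hθ1 : θ < 1)
    (hθ : ∀ (χ : AddChar B ℂ) (b : B), Separates m χ b → ‖charMean m χ b‖ ≤ θ)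
    {χ : AddChar B ℂ} (hχ : ¬ IsLight m δ v χ) :
    ∏ i, ‖charMean m χ (v i)‖ ≤ (θ ^ δ) ^ n := by
  classical
  calc ∏ i, ‖charMean m χ (v i)‖ ≤ ∏ i, (if Separates m χ (v i) then θ else 1) := by
        refine Finset.prod_le_prod (fun i _ => norm_nonneg _) fun i _ => ?_
        split_ifs with h
        · exact hθ _ _ h
        · exact norm_charMean_le_one hm _ _
    _ = θ ^ ((Finset.univ.filter fun i => Separates m χ (v i)).card : ℝ) := by
        rw [Finset.prod_ite, Finset.prod_const, Finset.prod_const_one, mul_one, Real.rpow_natCast]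
    _ ≤ θ ^ (δ * n) := by
        refine Real.rpow_le_rpow_of_exponent_ge hθ0 hθ1.le ?_
        unfold IsLight at hχ
        push Not at hχ
        convert hχ.le
    _ = (θ ^ δ) ^ n := by rw [Real.rpow_mul_natCast hθ0.le]

lemma prod_norm_charMean_le_one (hm : IsNondegenerateWeight m) (χ : AddChar B ℂ) :
    ∏ i, ‖charMean m χ (v i)‖ ≤ 1 :=
  Finset.prod_le_one (fun _ _ => norm_nonneg _) fun _ _ => norm_charMean_le_one hm _ _

lemma relationProb_le_sum_norm (hm : IsNondegenerateWeight m) [Fintype B] :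
    relationProb m v ≤ (∑ χ : AddChar B ℂ, ∏ i, ‖charMean m χ (v i)‖) / Fintype.card B := by
  have h := congrArg norm (relationProb_eq_sum m v)
  rw [Complex.norm_real, Real.norm_of_nonneg (relationProb_nonneg hm v), norm_div,
    Complex.norm_natCast] at h
  rw [h]
  gcongr
  refine (norm_sum_le _ _).trans_eq ?_
  simp

/-- If the light characters are trivial, the relation probability is nearly uniform. -/
lemma abs_relationProb_sub_le (hm : IsNondegenerateWeight m) (hθ0 : 0 < θ) (hθ1 : θ < 1)
    (hθ : ∀ (χ : AddChar B ℂ) (b : B), Separates m χ b → ‖charMean m χ b‖ ≤ θ)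
    (hv : lightKernel m δ v = ⊤) :
    |relationProb m v - 1 / Nat.card B| ≤ (θ ^ δ) ^ n := by
  classical
  have := Fintype.ofFinite B
  have hB : (0 : ℝ) < Fintype.card B := Nat.cast_pos.2 Fintype.card_pos
  have hlight : ∀ χ : AddChar B ℂ, χ ≠ 0 → ¬ IsLight m δ v χ := by
    intro χ hχ hl
    refine hχ (AddChar.eq_zero_iff.2 fun b => ?_)
    have hb : b ∈ lightKernel m δ v := hv ▸ AddSubgroup.mem_top b
    exact hb χ hl
  have h0 : ∏ i, charMean m (0 : AddChar B ℂ) (v i) = 1 := by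
    refine Finset.prod_eq_one fun i _ => ?_
    simp only [charMean, AddChar.zero_apply, mul_one]
    exact_mod_cast hm.sum_eq_one
  have h : ((relationProb m v - 1 / Nat.card B : ℝ) : ℂ) =
      (∑ χ ∈ Finset.univ.erase (0 : AddChar B ℂ), ∏ i, charMean m χ (v i)) / Fintype.card B := by
    push_cast
    rw [relationProb_eq_sum, ← Finset.add_sum_erase _ _ (Finset.mem_univ (0 : AddChar B ℂ)), h0,
      Nat.card_eq_fintype_card]
    ring
  have h' := congrArg norm h
  rw [Complex.norm_real, Real.norm_eq_abs, norm_div, Complex.norm_natCast] at h'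
  rw [h', div_le_iff₀ hB]
  have hκ : (0 : ℝ) ≤ (θ ^ δ) ^ n := by positivity
  calc _ ≤ ∑ χ ∈ Finset.univ.erase (0 : AddChar B ℂ), (θ ^ δ) ^ n := by
        refine (norm_sum_le _ _).trans (Finset.sum_le_sum fun χ hχ => ?_)
        rw [norm_prod]
        exact prod_norm_charMean_le_pow hm hθ0 hθ1 hθ (hlight χ (Finset.ne_of_mem_erase hχ))
    _ ≤ ∑ χ : AddChar B ℂ, (θ ^ δ) ^ n :=
        Finset.sum_le_sum_of_subset_of_nonneg (Finset.erase_subset _ _) fun _ _ _ => hκ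
    _ = (θ ^ δ) ^ n * Fintype.card B := by
        rw [Finset.sum_const, Finset.card_univ, AddChar.card_eq, nsmul_eq_mul, mul_comm]

omit [Fintype R] in
-- If the entries lay in a proper submodule `N`, a nontrivial character of `B ⧸ N` would separate
-- none of them, hence be light without being trivial.
lemma span_eq_top_of_lightKernel_eq_top (hδ : 0 ≤ δ) (hv : lightKernel m δ v = ⊤) :
    Submodule.span R (Set.range v) = ⊤ := by
  classical
  by_contra hne
  set N := Submodule.span R (Set.range v)
  have hlt : ∃ b, b ∉ N := by
    by_contra! h
    exact hne ((Submodule.eq_top_iff').2 h)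
  obtain ⟨b, hb⟩ := hlt
  have hb' : (Submodule.Quotient.mk b : B ⧸ N) ≠ 0 := by
    rwa [Ne, Submodule.Quotient.mk_eq_zero]
  have : Finite (B ⧸ N) := Finite.of_surjective _ N.mkQ_surjective
  obtain ⟨ψ, hψ⟩ := AddChar.exists_apply_ne_zero.2 hb'
  have hlight : IsLight m δ v (ψ.compAddMonoidHom N.mkQ.toAddMonoidHom) := by
    unfold IsLight
    rw [Finset.filter_false_of_mem]
    · simpa using by positivity
    · rintro i - ⟨x, y, -, -, h⟩
      apply h
      have : N.mkQ ((x - y) • v i) = 0 := by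
        rw [Submodule.mkQ_apply, Submodule.Quotient.mk_eq_zero]
        exact N.smul_mem _ (Submodule.subset_span ⟨i, rfl⟩)
      rw [AddChar.compAddMonoidHom_apply]
      change ψ (N.mkQ ((x - y) • v i)) = 1
      rw [this, AddChar.map_zero_eq_one]
  have hmem : b ∈ lightKernel m δ v := hv ▸ AddSubgroup.mem_top b
  exact hψ (hmem _ hlight)

open Classical in
-- Light characters are trivial on `lightKernel`, so every character outside the filtered sum is
-- heavy.
lemma sum_prod_norm_charMean_le (hm : IsNondegenerateWeight m) (hθ0 : 0 < θ) (hθ1 : θ < 1)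
    (hθ : ∀ (χ : AddChar B ℂ) (b : B), Separates m χ b → ‖charMean m χ b‖ ≤ θ) [Fintype B] :
    ∑ χ : AddChar B ℂ, ∏ i, ‖charMean m χ (v i)‖ ≤
      ∑ χ : AddChar B ℂ with ∀ b ∈ lightKernel m δ v, χ b = 1, ∏ i, ‖charMean m χ (v i)‖ +
        Fintype.card B * (θ ^ δ) ^ n := by
  have hκ : (0 : ℝ) ≤ (θ ^ δ) ^ n := by positivity
  rw [← Finset.sum_filter_add_sum_filter_not Finset.univ
    (fun χ : AddChar B ℂ => ∀ b ∈ lightKernel m δ v, χ b = 1)]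
  gcongr
  calc _ ≤ ∑ χ : AddChar B ℂ with ¬ ∀ b ∈ lightKernel m δ v, χ b = 1, (θ ^ δ) ^ n := by
        refine Finset.sum_le_sum fun χ hχ => ?_
        refine prod_norm_charMean_le_pow hm hθ0 hθ1 hθ fun hl => ?_
        exact (Finset.mem_filter.1 hχ).2 fun b hb => hb χ hl
    _ ≤ ∑ χ : AddChar B ℂ, (θ ^ δ) ^ n :=
        Finset.sum_le_sum_of_subset_of_nonneg (Finset.filter_subset _ _) fun _ _ _ => hκ
    _ = Fintype.card B * (θ ^ δ) ^ n := by
        rw [Finset.sum_const, Finset.card_univ, AddChar.card_eq, nsmul_eq_mul]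

/-- For integers, `a < b ≤ N` forces `a / b ≤ 1 - 1 / N`: a strict inequality of orders becomes a
factor `ρ` independent of the subgroups. -/
lemma inv_le_mul_inv_of_lt {a b N ρ : ℝ} (ha : 0 < a) (hab : a + 1 ≤ b) (hbN : b ≤ N)
    (hρ : 1 - 1 / N ≤ ρ) : 1 / b ≤ ρ / a := by
  have hb : 0 < b := by linarith
  rw [div_le_div_iff₀ hb ha]
  have h1 : 1 / N ≤ 1 / b := one_div_le_one_div_of_le hb hbN
  have h2 : (1 - 1 / b) * b ≤ ρ * b := by gcongr; linarith
  have h3 : (1 - 1 / b) * b = b - 1 := by field_simp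
  linarith

/-- If the light characters are not trivial, the relation probability is smaller by a constant
factor than the inverse order of the colon subgroup. -/
lemma relationProb_le_of_lightKernel_ne_top [IsLocalRing R] (hm : IsNondegenerateWeight m)
    (hθ0 : 0 < θ) (hθ1 : θ < 1)
    (hθ : ∀ (χ : AddChar B ℂ) (b : B), Separates m χ b → ‖charMean m χ b‖ ≤ θ)
    (hv : lightKernel m δ v ≠ ⊤) (hspan : Submodule.span R (Set.range v) = ⊤) :
    relationProb m v ≤ (1 - (1 - θ) / Nat.card B) /
      Nat.card (differenceColon m (lightKernel m δ v)) + (θ ^ δ) ^ n := by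
  classical
  have := Fintype.ofFinite B
  set H := lightKernel m δ v
  set C := differenceColon m H
  have hB : (0 : ℝ) < Nat.card B := Nat.cast_pos.2 Nat.card_pos
  have hC : (0 : ℝ) < Nat.card C := Nat.cast_pos.2 Nat.card_pos
  have hH : (0 : ℝ) < Nat.card H := Nat.cast_pos.2 Nat.card_pos
  have hHB : (Nat.card H : ℝ) ≤ Nat.card B := Nat.cast_le.2 (Nat.card_le_card_of_injective _ H.subtype_injective)
  set Λ := Finset.univ.filter fun χ : AddChar B ℂ => ∀ b ∈ H, χ b = 1
  have hΛcard : (Λ.card : ℝ) * Nat.card H = Nat.card B := by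
    have := card_addChar_trivialOn H
    rw [Nat.card_eq_fintype_card, Fintype.card_subtype] at this
    exact_mod_cast this
  have hΛ : (Λ.card : ℝ) = Nat.card B / Nat.card H := by
    rw [eq_div_iff hH.ne', hΛcard]
  have hsum := (relationProb_le_sum_norm (v := v) hm).trans
    (div_le_div_of_nonneg_right (sum_prod_norm_charMean_le (δ := δ) (v := v) hm hθ0 hθ1 hθ)
      (Nat.cast_nonneg _))
  rw [add_div, ← Nat.card_eq_fintype_card, mul_div_cancel_left₀ _ hB.ne'] at hsum
  refine hsum.trans (add_le_add_left ?_ _)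
  have hone : ∀ χ ∈ Λ, ∏ i, ‖charMean m χ (v i)‖ ≤ 1 :=
    fun χ _ => prod_norm_charMean_le_one hm χ
  -- The gain comes from `|C| < |H|` if all entries lie in `C`. Otherwise one light character has
  -- product at most `θ`, which lowers the bound `1 / |H|` by `(1 - θ) / |B|`.
  by_cases hall : ∀ i, v i ∈ C
  · have hlt : (Nat.card C : ℝ) + 1 ≤ Nat.card H := by
      exact_mod_cast card_differenceColon_lt hm hv hspan hall
    have h1 : ∑ χ ∈ Λ, ∏ i, ‖charMean m χ (v i)‖ ≤ Λ.card := by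
      simpa using Finset.sum_le_sum hone
    calc _ ≤ (Λ.card : ℝ) / Nat.card B := by gcongr
      _ = 1 / Nat.card H := by rw [hΛ]; field_simp
      _ ≤ _ := by
        refine inv_le_mul_inv_of_lt hC hlt hHB ?_
        gcongr
        linarith
  · push Not at hall
    obtain ⟨i, hi⟩ := hall
    obtain ⟨χ₀, hl, hs⟩ := exists_isLight_separates hi
    have hmem : χ₀ ∈ Λ := Finset.mem_filter.2 ⟨Finset.mem_univ _, fun b hb => hb χ₀ hl⟩
    have hle : ∏ i, ‖charMean m χ₀ (v i)‖ ≤ θ := by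
      rw [← Finset.mul_prod_erase _ _ (Finset.mem_univ i)]
      refine (mul_le_of_le_one_right (norm_nonneg _) ?_).trans (hθ _ _ hs)
      exact Finset.prod_le_one (fun _ _ => norm_nonneg _) fun _ _ => norm_charMean_le_one hm _ _
    have h1 : ∑ χ ∈ Λ, ∏ i, ‖charMean m χ (v i)‖ ≤ Λ.card - (1 - θ) := by
      rw [← Finset.add_sum_erase _ _ hmem]
      have h2 : ∑ χ ∈ Λ.erase χ₀, ∏ i, ‖charMean m χ (v i)‖ ≤ (Λ.erase χ₀).card := by
        simpa using Finset.sum_le_sum fun χ hχ => hone χ (Finset.mem_of_mem_erase hχ)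
      have h3 : ((Λ.erase χ₀).card : ℝ) + 1 = Λ.card := by
        exact_mod_cast Finset.card_erase_add_one hmem
      linarith
    have hCH : (Nat.card C : ℝ) ≤ Nat.card H := Nat.cast_le.2 (card_differenceColon_le hm H)
    have hH1 : (1 : ℝ) ≤ Nat.card H := Nat.one_le_cast.2 Nat.card_pos
    have hB1 : (1 : ℝ) ≤ Nat.card B := Nat.one_le_cast.2 Nat.card_pos
    have hρ : (0 : ℝ) ≤ 1 - (1 - θ) / Nat.card B := by
      rw [sub_nonneg, div_le_one hB]
      linarith
    calc _ ≤ ((Λ.card : ℝ) - (1 - θ)) / Nat.card B := by gcongr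
      _ = 1 / Nat.card H - (1 - θ) / Nat.card B := by rw [hΛ]; field_simp
      _ ≤ 1 / Nat.card H - (1 - θ) / Nat.card B / Nat.card H := by
        refine sub_le_sub_left ?_ _
        exact div_le_self (div_nonneg (by linarith) hB.le) hH1
      _ = (1 - (1 - θ) / Nat.card B) / Nat.card H := by ring
      _ ≤ _ := by gcongr

/-- Lets the uniform term of the error be absorbed in the same bound as the relation probability. -/
lemma inv_card_le_of_lightKernel_ne_top [IsLocalRing R] (hm : IsNondegenerateWeight m)
    (hθ0 : 0 < θ) (hv : lightKernel m δ v ≠ ⊤) :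
    1 / (Nat.card B : ℝ) ≤ (1 - (1 - θ) / Nat.card B) /
      Nat.card (differenceColon m (lightKernel m δ v)) := by
  have hC : (0 : ℝ) < Nat.card (differenceColon m (lightKernel m δ v)) :=
    Nat.cast_pos.2 Nat.card_pos
  refine inv_le_mul_inv_of_lt hC ?_ le_rfl (by gcongr; linarith)
  have h1 := card_differenceColon_le hm (lightKernel m δ v)
  have h2 : Nat.card (lightKernel m δ v) < Nat.card B :=
    lt_of_le_of_ne (Nat.card_le_card_of_injective _ (AddSubgroup.subtype_injective _))
      fun h => hv ((AddSubgroup.card_eq_iff_eq_top _).1 h)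
  exact_mod_cast h1.trans_lt h2

end Dichotomy

/-! ### Counting families concentrated on a subset -/

section Counting

lemma exists_rpow_eq {t a : ℝ} (ht : 1 < t) (ha : 1 < a) : ∃ δ : ℝ, 0 < δ ∧ t ^ δ = a := by
  refine ⟨Real.log a / Real.log t, div_pos (Real.log_pos ha) (Real.log_pos ht), ?_⟩
  rw [Real.rpow_def_of_pos (by linarith), mul_div_cancel₀ _ (Real.log_pos ht).ne',
    Real.exp_log (by linarith)]

open Classical in
/-- A Chernoff bound for the number of words with few letters outside a given set. -/
lemma exists_card_filter_notMem_le (B : Type*) [Fintype B] [Nonempty B] {η : ℝ} (hη : 0 < η) :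
    ∃ δ : ℝ, 0 < δ ∧ ∀ (C : Set B) (n : ℕ),
      ((Finset.univ.filter fun v : Fin n → B =>
        ((Finset.univ.filter fun i => v i ∉ C).card : ℝ) ≤ δ * n).card : ℝ) ≤
          (Nat.card C + η) ^ n := by
  set N : ℝ := (Fintype.card B : ℝ)
  have hN : 0 < N := Nat.cast_pos.2 Fintype.card_pos
  -- Each letter outside `C` gets weight `t⁻¹`. This `t` makes all those weights add up to at most
  -- `η / 2`; then `δ` is so small that `t ^ δ` costs only another `η / 2`.
  set t : ℝ := 1 + 2 * N / η
  have ht1 : 1 < t := lt_add_of_pos_right _ (by positivity)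
  have ht0 : 0 < t := by linarith
  obtain ⟨δ, hδ, hδt⟩ := exists_rpow_eq ht1
    (lt_add_of_pos_right 1 (show 0 < η / 2 / (N + η / 2) by positivity))
  refine ⟨δ, hδ, fun C n => ?_⟩
  have hCN : (Nat.card C : ℝ) ≤ N := by
    rw [Nat.card_eq_fintype_card]
    exact Nat.cast_le.2 (Fintype.card_subtype_le _)
  have hsum : ∑ b : B, (if b ∈ C then 1 else t⁻¹) ≤ Nat.card C + η / 2 := by
    calc ∑ b : B, (if b ∈ C then 1 else t⁻¹)
        ≤ ∑ b : B, ((if b ∈ C then 1 else 0) + t⁻¹) := by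
          refine Finset.sum_le_sum fun b _ => ?_
          have : 0 < t⁻¹ := inv_pos.2 ht0
          split_ifs <;> linarith
      _ = Nat.card C + N * t⁻¹ := by
          rw [Finset.sum_add_distrib, Finset.sum_boole, Finset.sum_const, Finset.card_univ,
            nsmul_eq_mul, Nat.card_eq_fintype_card, Fintype.card_subtype]
      _ ≤ Nat.card C + η / 2 := by
          gcongr
          rw [← div_eq_mul_inv, div_le_iff₀ ht0]
          have : η / 2 * t = η / 2 + N := by simp only [t]; field_simp
          linarith
  calc _ = ∑ v : Fin n → B,
        (if ((Finset.univ.filter fun i => v i ∉ C).card : ℝ) ≤ δ * n then (1 : ℝ) else 0) := by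
          rw [Finset.sum_boole]
    _ ≤ ∑ v : Fin n → B, (t ^ δ) ^ n * ∏ i, (if v i ∈ C then 1 else t⁻¹) := by
        refine Finset.sum_le_sum fun v _ => ?_
        have hprod : ∏ i, (if v i ∈ C then 1 else t⁻¹) =
            (t ^ ((Finset.univ.filter fun i => v i ∉ C).card : ℝ))⁻¹ := by
          rw [Finset.prod_ite, Finset.prod_const_one, one_mul, Finset.prod_const, inv_pow,
            Real.rpow_natCast]
        rw [hprod, ← Real.rpow_mul_natCast ht0.le, ← Real.rpow_neg ht0.le, ← Real.rpow_add ht0]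
        split_ifs with h
        · exact Real.one_le_rpow ht1.le (by linarith)
        · positivity
    _ = (t ^ δ * ∑ b : B, (if b ∈ C then 1 else t⁻¹)) ^ n := by
        rw [← Finset.mul_sum, mul_pow, Fintype.sum_pow]
    _ ≤ (Nat.card C + η) ^ n := by
        have h0 : 0 ≤ ∑ b : B, (if b ∈ C then 1 else t⁻¹) :=
          Finset.sum_nonneg fun b _ => by split_ifs <;> positivity
        gcongr
        calc t ^ δ * ∑ b : B, (if b ∈ C then 1 else t⁻¹)
            ≤ (1 + η / 2 / (N + η / 2)) * (Nat.card C + η / 2) := by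
              rw [hδt]; gcongr
          _ = Nat.card C + η / 2 + η / 2 * ((Nat.card C + η / 2) / (N + η / 2)) := by ring
          _ ≤ Nat.card C + η / 2 + η / 2 * 1 := by
              gcongr
              rw [div_le_one (by positivity)]
              linarith
          _ = Nat.card C + η := by ring

end Counting

/-! ### Elementary limits -/

section Limits

lemma abs_pow_sub_pow_le_add_pow_sub_pow {a b e : ℝ} (ha : 0 ≤ a) (hb : 0 ≤ b)
    (h : |a - b| ≤ e) (k : ℕ) : |a ^ k - b ^ k| ≤ (b + e) ^ k - b ^ k := by
  induction k with
  | zero => simp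
  | succ k ih =>
    have hab : a ≤ b + e := by linarith [le_abs_self (a - b)]
    have hk : a ^ k ≤ (b + e) ^ k := by gcongr
    have he : 0 ≤ e := (abs_nonneg _).trans h
    calc |a ^ (k + 1) - b ^ (k + 1)| = |b * (a ^ k - b ^ k) + a ^ k * (a - b)| := by
          congr 1; ring
      _ ≤ |b * (a ^ k - b ^ k)| + |a ^ k * (a - b)| := abs_add_le _ _
      _ = b * |a ^ k - b ^ k| + a ^ k * |a - b| := by
          rw [abs_mul, abs_mul, abs_of_nonneg hb, abs_of_nonneg (pow_nonneg ha k)]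
      _ ≤ b * ((b + e) ^ k - b ^ k) + (b + e) ^ k * e := by gcongr
      _ = (b + e) ^ (k + 1) - b ^ (k + 1) := by ring

lemma tendsto_pow_atTop_nhds_zero_of_tendsto_lt_one {a : ℕ → ℝ} {L : ℝ} (ha : ∀ n, 0 ≤ a n)
    (h : Tendsto a atTop (𝓝 L)) (hL : L < 1) : Tendsto (fun n => a n ^ n) atTop (𝓝 0) := by
  obtain ⟨r, hLr, hr⟩ := exists_between hL
  have hr0 : 0 ≤ r := (ge_of_tendsto' h ha).trans hLr.le
  refine squeeze_zero' (Eventually.of_forall fun n => pow_nonneg (ha n) n) ?_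
    (tendsto_pow_atTop_nhds_zero_of_lt_one hr0 hr)
  filter_upwards [h.eventually_lt_const hLr] with n hn
  exact pow_le_pow_left₀ (ha n) hn.le n

lemma tendsto_one_add_mul_pow_pow {κ N : ℝ} (hκ0 : 0 ≤ κ) (hκ1 : κ < 1) (hN : 0 ≤ N) (u : ℕ) :
    Tendsto (fun n : ℕ => (1 + N * κ ^ n) ^ (n + u)) atTop (𝓝 1) := by
  have h1 : Tendsto (fun n : ℕ => Real.exp ((N * κ ^ n) * (n + u : ℕ))) atTop (𝓝 1) := by
    have h2 : Tendsto (fun n : ℕ => N * (n * κ ^ n) + N * u * κ ^ n) atTop (𝓝 0) := by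
      simpa using ((tendsto_self_mul_const_pow_of_lt_one hκ0 hκ1).const_mul N).add
        ((tendsto_pow_atTop_nhds_zero_of_lt_one hκ0 hκ1).const_mul (N * u))
    have h3 := (Real.continuous_exp.tendsto 0).comp h2
    rw [Real.exp_zero] at h3
    refine h3.congr fun n => ?_
    simp only [Function.comp]
    congr 1
    push_cast
    ring
  refine tendsto_of_tendsto_of_tendsto_of_le_of_le tendsto_const_nhds h1 (fun n => ?_) fun n => ?_
  · exact one_le_pow₀ (le_add_of_nonneg_right (by positivity))
  · change (1 + N * κ ^ n) ^ (n + u) ≤ _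
    rw [mul_comm (N * κ ^ n), Real.exp_nat_mul]
    gcongr
    rw [add_comm]
    exact Real.add_one_le_exp _

lemma tendsto_add_pow_mul_div_add_pow {c η ρ κ : ℝ} (hc : 1 ≤ c) (hη : 0 ≤ η) (hρ : 0 ≤ ρ)
    (hηρ : (1 + η) * ρ < 1) (hκ0 : 0 ≤ κ) (hκ1 : κ < 1) (u : ℕ) :
    Tendsto (fun n : ℕ => (c + η) ^ n * (ρ / c + κ ^ n) ^ (n + u)) atTop (𝓝 0) := by
  have h0 : Tendsto (fun n : ℕ => ρ / c + κ ^ n) atTop (𝓝 (ρ / c)) := by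
    simpa using (tendsto_pow_atTop_nhds_zero_of_lt_one hκ0 hκ1).const_add (ρ / c)
  have h1 := h0.const_mul (c + η)
  have hL : (c + η) * (ρ / c) < 1 := by
    refine lt_of_le_of_lt ?_ hηρ
    have : (c + η) * (ρ / c) = (1 + η / c) * ρ := by field_simp
    rw [this]
    gcongr
    exact div_le_self hη hc
  have h2 := (tendsto_pow_atTop_nhds_zero_of_tendsto_lt_one (fun n => by positivity) h1 hL).mul
    (h0.pow u)
  rw [zero_mul] at h2
  refine h2.congr fun n => ?_
  rw [pow_add, mul_pow]
  ring

end Limits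

/-! ### Convergence of moments with summed errors -/

section Moments

variable {R : Type*} [CommRing R] [IsLocalRing R] [Fintype R] {m : R → ℝ}

open Classical in
/-- The moments of the cokernel converge to those of the uniform model, uniformly in the strong
sense that the sum of the absolute errors over all candidate generating families tends to zero. -/
theorem tendsto_sum_abs_relationProb_sub (hm : IsNondegenerateWeight m) (u : ℕ)
    (B : Type*) [AddCommGroup B] [Module R B] [Fintype B] :
    Tendsto (fun n : ℕ => ∑ v : Fin n → B,
      |(if Submodule.span R (Set.range v) = ⊤ then relationProb m v ^ (n + u) else 0) -
        (1 / (Nat.card B : ℝ)) ^ (n + u)|) atTop (𝓝 0) := by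
  obtain ⟨θ, hθ0, hθ1, hθ⟩ := exists_norm_charMean_le hm B
  set N : ℝ := (Nat.card B : ℝ)
  have hN : 0 < N := Nat.cast_pos.2 Nat.card_pos
  have hN1 : 1 ≤ N := Nat.one_le_cast.2 Nat.card_pos
  set ρ : ℝ := 1 - (1 - θ) / N
  have hρ0 : 0 ≤ ρ := by
    rw [sub_nonneg, div_le_one hN]
    linarith
  have hρ1 : ρ < 1 := sub_lt_self _ (div_pos (by linarith) hN)
  -- Small enough that the counting loss `1 + η` does not use up the gain `ρ`.
  set η : ℝ := (1 - ρ) / 2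
  have hη : 0 < η := by simp only [η]; linarith
  have hηρ : (1 + η) * ρ < 1 := by
    have : η * ρ ≤ η * 1 := by gcongr
    simp only [η] at this ⊢
    linarith
  obtain ⟨δ', hδ', hcount⟩ := exists_card_filter_notMem_le B hη
  -- Up to `N` light characters together may push `N δ n = δ' n` entries out of the colon subgroup.
  set δ : ℝ := δ' / N
  have hδ : 0 < δ := by positivity
  set κ : ℝ := θ ^ δ
  have hκ0 : 0 ≤ κ := by positivity
  have hκ1 : κ < 1 := Real.rpow_lt_one hθ0.le hθ1 hδ
  -- The bracket covers families whose light characters are all trivial. For any other, its own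
  -- colon subgroup supplies one term of the sum; the number of subgroups does not depend on `n`.
  have hpt : ∀ (n : ℕ) (v : Fin n → B),
      |(if Submodule.span R (Set.range v) = ⊤ then relationProb m v ^ (n + u) else 0) -
        (1 / N) ^ (n + u)| ≤ ((1 / N + κ ^ n) ^ (n + u) - (1 / N) ^ (n + u)) +
        ∑ C : AddSubgroup B,
          (if ((Finset.univ.filter fun i => v i ∉ (C : Set B)).card : ℝ) ≤ δ' * n then 1 else 0) *
            (ρ / Nat.card C + κ ^ n) ^ (n + u) := by
    intro n v
    have hκn : 0 ≤ κ ^ n := by positivity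
    have hterm : ∀ C : AddSubgroup B, 0 ≤
          (if ((Finset.univ.filter fun i => v i ∉ (C : Set B)).card : ℝ) ≤ δ' * n then 1 else 0) *
            (ρ / Nat.card C + κ ^ n) ^ (n + u) := fun C => by
      split_ifs <;> positivity
    by_cases hv : lightKernel m δ v = ⊤
    · rw [if_pos (span_eq_top_of_lightKernel_eq_top hδ.le hv)]
      refine (abs_pow_sub_pow_le_add_pow_sub_pow (relationProb_nonneg hm v) (by positivity)
        (abs_relationProb_sub_le hm hθ0 hθ1 hθ hv) _).trans ?_
      exact le_add_of_nonneg_right (Finset.sum_nonneg fun C _ => hterm C)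
    · have h1 : 0 ≤ (1 / N + κ ^ n) ^ (n + u) - (1 / N) ^ (n + u) := by
        rw [sub_nonneg]
        gcongr
        linarith
      refine le_add_of_nonneg_of_le h1 (le_trans ?_ (Finset.single_le_sum (fun C _ => hterm C)
        (Finset.mem_univ (differenceColon m (lightKernel m δ v)))))
      have hcard : ((Finset.univ.filter fun i =>
          v i ∉ ((differenceColon m (lightKernel m δ v) : AddSubgroup B) : Set B)).card : ℝ) ≤
          δ' * n := by
        have := card_notMem_differenceColon_le (m := m) hδ.le v
        rw [mul_div_cancel₀ _ hN.ne'] at this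
        exact this
      rw [if_pos hcard, one_mul]
      have h2 := inv_card_le_of_lightKernel_ne_top (θ := θ) hm hθ0 hv
      have h3 : (1 / N) ^ (n + u) ≤ (ρ / Nat.card (differenceColon m (lightKernel m δ v)) + κ ^ n)
          ^ (n + u) := by
        gcongr
        linarith
      have h4 : (0 : ℝ) ≤ (1 / N) ^ (n + u) := by positivity
      split_ifs with hs
      · have h5 := relationProb_le_of_lightKernel_ne_top hm hθ0 hθ1 hθ hv hs
        have h6 := pow_le_pow_left₀ (relationProb_nonneg hm v) h5 (n + u)
        have h7 := pow_nonneg (relationProb_nonneg hm v) (n + u)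
        rw [abs_le]
        constructor <;> linarith
      · rw [zero_sub, abs_neg, abs_of_nonneg h4]
        exact h3
  have hbound : ∀ n : ℕ, ∑ v : Fin n → B,
      |(if Submodule.span R (Set.range v) = ⊤ then relationProb m v ^ (n + u) else 0) -
        (1 / N) ^ (n + u)| ≤ (1 / N) ^ u * ((1 + N * κ ^ n) ^ (n + u) - 1) +
        ∑ C : AddSubgroup B, (Nat.card C + η) ^ n * (ρ / Nat.card C + κ ^ n) ^ (n + u) := by
    intro n
    refine (Finset.sum_le_sum fun v _ => hpt n v).trans ?_
    rw [Finset.sum_add_distrib]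
    refine add_le_add (le_of_eq ?_) ?_
    · rw [Finset.sum_const, Finset.card_univ, Fintype.card_pi_const, nsmul_eq_mul,
        ← Nat.card_eq_fintype_card, Nat.cast_pow]
      have : 1 / N + κ ^ n = 1 / N * (1 + N * κ ^ n) := by field_simp
      rw [this, mul_pow, pow_add (1 / N)]
      change N ^ n * _ = _
      have h8 : N ^ n * (1 / N) ^ n = 1 := by
        rw [← mul_pow, mul_one_div_cancel hN.ne', one_pow]
      linear_combination (1 / N) ^ u * ((1 + N * κ ^ n) ^ (n + u) - 1) * h8
    · rw [Finset.sum_comm]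
      refine Finset.sum_le_sum fun C _ => ?_
      rw [← Finset.sum_mul, Finset.sum_boole]
      gcongr
      exact hcount C n
  refine squeeze_zero (fun n => Finset.sum_nonneg fun v _ => abs_nonneg _) hbound ?_
  have h9 := ((tendsto_one_add_mul_pow_pow hκ0 hκ1 hN.le u).sub_const 1).const_mul ((1 / N) ^ u)
  have h10 := tendsto_finsetSum (Finset.univ : Finset (AddSubgroup B)) fun C _ =>
    tendsto_add_pow_mul_div_add_pow (c := Nat.card C) (Nat.one_le_cast.2 Nat.card_pos) hη.le hρ0
      hηρ hκ0 hκ1 u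
  simpa using h9.add h10

end Moments

/-! ### Functionals to the residue field and numbers of generators -/

section ResidueDual

variable {R : Type*} [CommRing R] [IsLocalRing R]
  {K : Type*} [AddCommGroup K] [Module R K]

/-- The linear functionals with values in the residue field that vanish on `W`. -/
def residueAnnihilator (W : Submodule R K) :
    Submodule (IsLocalRing.ResidueField R) (K →ₗ[R] IsLocalRing.ResidueField R) where
  carrier := {g | ∀ w ∈ W, g w = 0}
  zero_mem' := fun _ _ => rfl
  add_mem' := fun {a b} ha hb w hw => by rw [LinearMap.add_apply, ha w hw, hb w hw, add_zero]
  smul_mem' := fun c a ha w hw => by rw [LinearMap.smul_apply, ha w hw, smul_zero]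

/-- A form of Nakayama's lemma: a proper submodule lies in a maximal one, whose simple quotient is
the residue field. -/
lemma residueAnnihilator_eq_bot_iff [Module.Finite R K] {W : Submodule R K} :
    residueAnnihilator W = ⊥ ↔ W = ⊤ := by
  constructor
  · intro h
    by_contra hW
    obtain ⟨N, hN, hWN⟩ := (eq_top_or_exists_le_coatom W).resolve_left hW
    have : IsSimpleModule R (K ⧸ N) := isSimpleModule_iff_isCoatom.2 hN
    obtain ⟨I, hI, ⟨e⟩⟩ := isSimpleModule_iff_quot_maximal.1 this
    obtain rfl := IsLocalRing.eq_maximalIdeal hI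
    let g : K →ₗ[R] IsLocalRing.ResidueField R := e.toLinearMap ∘ₗ N.mkQ
    have hg : g ∈ residueAnnihilator W := by
      intro w hw
      have : N.mkQ w = 0 := (Submodule.Quotient.mk_eq_zero N).2 (hWN hw)
      change e (N.mkQ w) = 0
      rw [this, map_zero]
    rw [h, Submodule.mem_bot] at hg
    refine hN.1 (Submodule.eq_top_iff'.2 fun x => ?_)
    have hx : e (N.mkQ x) = 0 := LinearMap.congr_fun hg x
    rw [e.map_eq_zero_iff] at hx
    exact (Submodule.Quotient.mk_eq_zero N).1 hx
  · rintro rfl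
    rw [eq_bot_iff]
    intro g hg
    rw [Submodule.mem_bot]
    ext x
    exact hg x Submodule.mem_top

/-- The image is a subspace over the residue field; a nonzero functional vanishing on it would be a
linear relation among the `g i`. -/
lemma surjective_pi_of_linearIndependent {j : ℕ} {g : Fin j → K →ₗ[R] IsLocalRing.ResidueField R}
    (hg : LinearIndependent (IsLocalRing.ResidueField R) g) :
    Function.Surjective (LinearMap.pi g) := by
  let p : Submodule (IsLocalRing.ResidueField R) (Fin j → IsLocalRing.ResidueField R) :=
    { LinearMap.range (LinearMap.pi g) with
      smul_mem' := by
        rintro c _ ⟨x, rfl⟩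
        obtain ⟨r, rfl⟩ := IsLocalRing.residue_surjective c
        refine ⟨r • x, ?_⟩
        ext i
        simp [Algebra.smul_def] }
  by_cases hp : p = ⊤
  · intro y
    have : y ∈ p := hp ▸ Submodule.mem_top
    exact this
  · exfalso
    obtain ⟨f, hf, hfp⟩ := Submodule.exists_le_ker_of_lt_top p (lt_top_iff_ne_top.2 hp)
    have hsum : ∀ y, f y = ∑ i, f (Pi.single i 1) * y i := by
      intro y
      conv_lhs => rw [← Finset.univ_sum_single y]
      rw [map_sum]
      refine Finset.sum_congr rfl fun i _ => ?_
      have : Pi.single i (y i) =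
          y i • (Pi.single i 1 : Fin j → IsLocalRing.ResidueField R) := by
        rw [← Pi.single_smul, smul_eq_mul, mul_one]
      rw [this, map_smul, smul_eq_mul, mul_comm]
    have hz : ∑ i, f (Pi.single i 1) • g i = 0 := by
      ext x
      have h1 : f (LinearMap.pi g x) = 0 := hfp ⟨x, rfl⟩
      rw [hsum] at h1
      simpa [LinearMap.sum_apply] using h1
    have hc := Fintype.linearIndependent_iff.1 hg _ hz
    apply hf
    apply LinearMap.ext
    intro y
    rw [hsum]
    simp [hc]

instance [Finite R] : Finite (IsLocalRing.ResidueField R) :=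
  Finite.of_surjective _ IsLocalRing.residue_surjective

instance [Finite R] [Finite K] : Finite (K →ₗ[R] IsLocalRing.ResidueField R) :=
  DFunLike.finite _

/-- A module is generated by as many elements as the dimension of its residue dual. -/
lemma exists_span_eq_top_of_finrank [Finite R] [Finite K] :
    ∃ x : Fin (Module.finrank (IsLocalRing.ResidueField R) (K →ₗ[R] IsLocalRing.ResidueField R)) → K,
      Submodule.span R (Set.range x) = ⊤ := by
  let b := Module.finBasis (IsLocalRing.ResidueField R) (K →ₗ[R] IsLocalRing.ResidueField R)
  have hs := surjective_pi_of_linearIndependent b.linearIndependent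
  -- Elements dual to the basis `b`: a functional vanishing on all of them has zero coordinates.
  choose x hx using fun i => hs (Pi.single i 1)
  refine ⟨x, residueAnnihilator_eq_bot_iff.1 (eq_bot_iff.2 fun g hg => ?_)⟩
  rw [Submodule.mem_bot, ← b.sum_repr g]
  refine Finset.sum_eq_zero fun i _ => ?_
  have h1 : g (x i) = 0 := hg _ (Submodule.subset_span ⟨i, rfl⟩)
  have h2 : ∀ a, b a (x i) = Pi.single (M := fun _ => IsLocalRing.ResidueField R) i 1 a :=
    fun a => congrFun (hx i) a
  rw [← b.sum_repr g, LinearMap.sum_apply] at h1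
  simp only [LinearMap.smul_apply, h2, smul_eq_mul] at h1
  rw [Finset.sum_eq_single i (fun a _ ha => by rw [Pi.single_eq_of_ne ha, mul_zero]) (by simp),
    Pi.single_eq_same, mul_one] at h1
  rw [h1, zero_smul]

lemma finrank_residueDual_le_of_span_eq_top [Finite R] [Finite K] {r : ℕ} {x : Fin r → K}
    (hx : Submodule.span R (Set.range x) = ⊤) :
    Module.finrank (IsLocalRing.ResidueField R) (K →ₗ[R] IsLocalRing.ResidueField R) ≤ r := by
  let ev : (K →ₗ[R] IsLocalRing.ResidueField R) →ₗ[IsLocalRing.ResidueField R]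
      (Fin r → IsLocalRing.ResidueField R) :=
    { toFun := fun g i => g (x i)
      map_add' := fun _ _ => rfl
      map_smul' := fun _ _ => rfl }
  have hinj : Function.Injective ev := by
    intro g h hgh
    refine LinearMap.ext_on_range hx fun i => congrFun hgh i
  simpa using LinearMap.finrank_le_finrank_of_injective hinj

lemma finrank_residueDual_prod [Finite R] [Finite K] (g : ℕ) :
    Module.finrank (IsLocalRing.ResidueField R) (K × (Fin g → R) →ₗ[R] IsLocalRing.ResidueField R) =
      Module.finrank (IsLocalRing.ResidueField R) (K →ₗ[R] IsLocalRing.ResidueField R) + g := by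
  rw [← (LinearMap.coprodEquiv (R := R) (M := K) (M₂ := Fin g → R)
    (M₃ := IsLocalRing.ResidueField R) (IsLocalRing.ResidueField R)).finrank_eq,
    Module.finrank_prod, ← ((Pi.basisFun R (Fin g)).constr (M' := IsLocalRing.ResidueField R)
      (IsLocalRing.ResidueField R)).finrank_eq, Module.finrank_fin_fun]

lemma finrank_residueDual_congr {K' : Type*} [AddCommGroup K'] [Module R K'] (e : K ≃ₗ[R] K') :
    Module.finrank (IsLocalRing.ResidueField R) (K →ₗ[R] IsLocalRing.ResidueField R) =
      Module.finrank (IsLocalRing.ResidueField R) (K' →ₗ[R] IsLocalRing.ResidueField R) :=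
  (e.congrLeft _ _).finrank_eq

end ResidueDual

/-! ### Schanuel's lemma and the defect of a presentation -/

section Presentations

variable {R : Type*} [CommRing R] {A : Type*} [AddCommGroup A] [Module R A]

lemma surjective_linearCombination_iff {n : ℕ} {v : Fin n → A} :
    Function.Surjective (Fintype.linearCombination R v) ↔
      Submodule.span R (Set.range v) = ⊤ := by
  rw [← LinearMap.range_eq_top, Fintype.range_linearCombination]

/-- Schanuel's lemma for two surjections from free modules. -/
lemma nonempty_ker_prod_equiv {n g : ℕ} {F : (Fin n → R) →ₗ[R] A} {G : (Fin g → R) →ₗ[R] A}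
    (hF : Function.Surjective F) (hG : Function.Surjective G) :
    Nonempty ((LinearMap.ker F × (Fin g → R)) ≃ₗ[R] (LinearMap.ker G × (Fin n → R))) := by
  obtain ⟨φ, hφ⟩ := Module.projective_lifting_property G F hG
  obtain ⟨ψ, hψ⟩ := Module.projective_lifting_property F G hF
  have hφ' : ∀ x, G (φ x) = F x := fun x => LinearMap.congr_fun hφ x
  have hψ' : ∀ x, F (ψ x) = G x := fun x => LinearMap.congr_fun hψ x
  refine ⟨
    { toFun := fun p => (⟨p.2 + φ (p.1 - ψ p.2), ?_⟩, p.1 - ψ p.2)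
      invFun := fun p => (⟨p.2 + ψ (p.1 - φ p.2), ?_⟩, p.1 - φ p.2)
      map_add' := ?_
      map_smul' := ?_
      left_inv := ?_
      right_inv := ?_ }⟩
  · have := p.1.2
    rw [LinearMap.mem_ker] at this ⊢
    rw [map_add, hφ', map_sub, hψ', this]
    abel
  · intro p q
    ext <;> simp <;> ring
  · intro c p
    ext <;> simp <;> ring
  · have := p.1.2
    rw [LinearMap.mem_ker] at this ⊢
    rw [map_add, hψ', map_sub, hφ', this]
    abel
  · intro p
    ext <;> simp
  · intro p
    ext <;> simp

lemma finrank_residueDual_ker_add [IsLocalRing R] [Finite R] {n g : ℕ}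
    {F : (Fin n → R) →ₗ[R] A} {G : (Fin g → R) →ₗ[R] A}
    (hF : Function.Surjective F) (hG : Function.Surjective G) :
    Module.finrank (IsLocalRing.ResidueField R)
        (LinearMap.ker F →ₗ[R] IsLocalRing.ResidueField R) + g =
      Module.finrank (IsLocalRing.ResidueField R)
        (LinearMap.ker G →ₗ[R] IsLocalRing.ResidueField R) + n := by
  obtain ⟨e⟩ := nonempty_ker_prod_equiv hF hG
  rw [← finrank_residueDual_prod, ← finrank_residueDual_prod, finrank_residueDual_congr e]

/-- The least number of generators of the kernel is the dimension of its residue dual, and unused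
relations may be sent to zero. -/
lemma hasPresentation_iff [IsLocalRing R] [Finite R] {g r : ℕ} :
    HasPresentation R A g r ↔ ∃ G : (Fin g → R) →ₗ[R] A, Function.Surjective G ∧
      Module.finrank (IsLocalRing.ResidueField R)
        (LinearMap.ker G →ₗ[R] IsLocalRing.ResidueField R) ≤ r := by
  constructor
  · rintro ⟨φ, π, hex, hπ⟩
    refine ⟨π, hπ, ?_⟩
    have hker : LinearMap.ker π = LinearMap.range φ := hex.linearMap_ker_eq
    let φ' : (Fin r → R) →ₗ[R] LinearMap.ker π :=
      φ.codRestrict (LinearMap.ker π) fun x => hker ▸ ⟨x, rfl⟩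
    have hφ' : Function.Surjective φ' := by
      rintro ⟨y, hy⟩
      obtain ⟨x, hx⟩ := hker ▸ hy
      exact ⟨x, Subtype.ext hx⟩
    refine finrank_residueDual_le_of_span_eq_top (x := fun i => φ' (Pi.single i 1)) ?_
    rw [← surjective_linearCombination_iff]
    intro y
    obtain ⟨x, rfl⟩ := hφ' y
    refine ⟨x, ?_⟩
    rw [Fintype.linearCombination_apply]
    conv_rhs => rw [pi_eq_sum_univ' x]
    rw [map_sum]
    simp
  · rintro ⟨G, hG, hr⟩
    obtain ⟨x, hx⟩ := exists_span_eq_top_of_finrank (R := R) (K := LinearMap.ker G)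
    rw [← surjective_linearCombination_iff] at hx
    refine ⟨(LinearMap.ker G).subtype ∘ₗ Fintype.linearCombination R x ∘ₗ
      LinearMap.funLeft R R (Fin.castLE hr), G, ?_, hG⟩
    have hsurj : Function.Surjective
        (Fintype.linearCombination R x ∘ₗ LinearMap.funLeft R R (Fin.castLE hr)) :=
      hx.comp (LinearMap.funLeft_surjective_of_injective R R _ (Fin.castLE_injective hr))
    rw [LinearMap.exact_iff, LinearMap.range_comp, LinearMap.range_eq_top.2 hsurj,
      Submodule.map_top, Submodule.range_subtype]

/-- The number of generators of the kernel of a presentation is determined by the defect. -/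
lemma finrank_residueDual_ker_eq [IsLocalRing R] [Finite R] [Finite A] {n : ℕ}
    {F : (Fin n → R) →ₗ[R] A} (hF : Function.Surjective F) :
    (Module.finrank (IsLocalRing.ResidueField R)
      (LinearMap.ker F →ₗ[R] IsLocalRing.ResidueField R) : ℤ) = n - presentationDefect R A := by
  have hne : {g | ∃ r, HasPresentation R A g r}.Nonempty :=
    ⟨n, _, hasPresentation_iff.2 ⟨F, hF, le_rfl⟩⟩
  obtain ⟨r, hr⟩ : ∃ r, HasPresentation R A (minGenerators R A) r := Nat.sInf_mem hne
  obtain ⟨G, hG, -⟩ := hasPresentation_iff.1 hr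
  have hmin : minRelations R A = Module.finrank (IsLocalRing.ResidueField R)
      (LinearMap.ker G →ₗ[R] IsLocalRing.ResidueField R) := by
    refine le_antisymm (Nat.sInf_le (hasPresentation_iff.2 ⟨G, hG, le_rfl⟩)) ?_
    obtain ⟨G', hG', hle⟩ := hasPresentation_iff.1
      (show HasPresentation R A (minGenerators R A) (minRelations R A) from
        Nat.sInf_mem (s := {r | HasPresentation R A (minGenerators R A) r}) ⟨r, hr⟩)
    have := finrank_residueDual_ker_add hG hG'
    omega
  have := finrank_residueDual_ker_add hF hG
  rw [presentationDefect, hmin]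
  omega

end Presentations

/-! ### Euler's product and the alternating inequalities -/

section Euler

/-- The coefficients `(-1)^j / ∏ (q^i - 1)`, `1 ≤ i ≤ j`, of Euler's product. -/
noncomputable def eulerCoeff (q : ℝ) (j : ℕ) : ℝ :=
  (-1) ^ j / ∏ i ∈ Finset.range j, (q ^ (i + 1) - 1)

variable {q : ℝ}

lemma eulerCoeff_succ_mul (hq : 1 < q) (j : ℕ) :
    eulerCoeff q (j + 1) * (q ^ (j + 1) - 1) = - eulerCoeff q j := by
  have h : ∀ i : ℕ, q ^ (i + 1) - 1 ≠ 0 :=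
    fun i => (sub_pos.2 (one_lt_pow₀ hq (Nat.succ_ne_zero i))).ne'
  have hP : ∏ i ∈ Finset.range j, (q ^ (i + 1) - 1) ≠ 0 := Finset.prod_ne_zero_iff.2 fun i _ => h i
  have := h j
  rw [eulerCoeff, eulerCoeff, Finset.prod_range_succ]
  field_simp
  ring

/-- The truncated sum telescopes to one product, so at `x = q ^ s` its sign can be read off. -/
lemma sum_eulerCoeff_mul_prod (hq : 1 < q) (x : ℝ) (J : ℕ) :
    ∑ j ∈ Finset.range (J + 1), eulerCoeff q j * ∏ i ∈ Finset.range j, (x - q ^ i) =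
      eulerCoeff q J * ∏ i ∈ Finset.range J, (x - q ^ (i + 1)) := by
  induction J with
  | zero => simp
  | succ J ih =>
    rw [Finset.sum_range_succ, ih, Finset.prod_range_succ' (fun i => x - q ^ i),
      Finset.prod_range_succ (fun i => x - q ^ (i + 1))]
    have := eulerCoeff_succ_mul hq J
    rw [pow_zero]
    linear_combination (∏ i ∈ Finset.range J, (x - q ^ (i + 1))) * this

/-- Bonferroni inequalities over a finite field: the truncated alternating sums over linearly
independent tuples lie alternately above and below the indicator of dimension zero. -/
lemma bonferroni_nonneg (hq : 1 < q) (s J : ℕ) :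
    0 ≤ (-1) ^ J * (∑ j ∈ Finset.range (J + 1),
      eulerCoeff q j * ∏ i ∈ Finset.range j, (q ^ s - q ^ i) - if s = 0 then 1 else 0) := by
  have h : ∀ i : ℕ, 0 < q ^ (i + 1) - 1 := fun i => sub_pos.2 (one_lt_pow₀ hq (Nat.succ_ne_zero i))
  have hP : ∀ J : ℕ, 0 < ∏ i ∈ Finset.range J, (q ^ (i + 1) - 1) :=
    fun J => Finset.prod_pos fun i _ => h i
  have hsq : ((-1 : ℝ) ^ J) * (-1) ^ J = 1 := by rw [← mul_pow]; norm_num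
  rw [sum_eulerCoeff_mul_prod hq, eulerCoeff]
  split_ifs with hs
  · subst hs
    have h1 : ∏ i ∈ Finset.range J, (q ^ 0 - q ^ (i + 1)) =
        (-1) ^ J * ∏ i ∈ Finset.range J, (q ^ (i + 1) - 1) := by
      rw [← Finset.card_range J, ← Finset.prod_const, Finset.card_range, ← Finset.prod_mul_distrib]
      exact Finset.prod_congr rfl fun i _ => by ring
    rw [h1, div_mul_eq_mul_div, ← mul_assoc, hsq, one_mul, div_self (hP J).ne', sub_self, mul_zero]
  · rw [sub_zero, div_mul_eq_mul_div, ← mul_div_assoc, ← mul_assoc, hsq, one_mul]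
    refine div_nonneg ?_ (hP J).le
    -- For `1 ≤ s ≤ J` the factor with `i + 1 = s` vanishes; for `s > J` all factors are positive.
    by_cases hsJ : s ≤ J
    · refine (Finset.prod_eq_zero (i := s - 1) (Finset.mem_range.2 (by omega)) ?_).ge
      rw [Nat.sub_add_cancel (Nat.one_le_iff_ne_zero.2 hs), sub_self]
    · refine Finset.prod_nonneg fun i hi => sub_nonneg.2 (pow_le_pow_right₀ hq.le ?_)
      have := Finset.mem_range.1 hi
      omega

lemma summable_eulerCoeff_mul_pow (hq : 1 < q) {y : ℝ} (hy : 0 < y) :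
    Summable fun j => eulerCoeff q j * y ^ j := by
  have h : ∀ i : ℕ, 0 < q ^ (i + 1) - 1 := fun i => sub_pos.2 (one_lt_pow₀ hq (Nat.succ_ne_zero i))
  have hne : ∀ j, eulerCoeff q j ≠ 0 := fun j =>
    div_ne_zero (pow_ne_zero _ (by norm_num)) (Finset.prod_pos fun i _ => h i).ne'
  refine summable_of_ratio_test_tendsto_lt_one (l := 0) one_pos
    (Eventually.of_forall fun j => mul_ne_zero (hne j) (pow_ne_zero _ hy.ne')) ?_
  have hlim : Tendsto (fun j : ℕ => y / (q ^ (j + 1) - 1)) atTop (𝓝 0) := by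
    refine Tendsto.div_atTop tendsto_const_nhds ?_
    exact tendsto_atTop_add_const_right _ _
      ((tendsto_pow_atTop_atTop_of_one_lt hq).comp (tendsto_add_atTop_nat 1))
  refine hlim.congr fun j => ?_
  rw [← norm_div, pow_succ y, mul_div_mul_comm]
  have h1 : eulerCoeff q (j + 1) / eulerCoeff q j = -1 / (q ^ (j + 1) - 1) := by
    rw [div_eq_div_iff (hne j) (h j).ne', eulerCoeff_succ_mul hq]
    ring
  rw [h1, mul_div_cancel_left₀ _ (pow_ne_zero j hy.ne'), norm_mul, norm_div, norm_neg, norm_one,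
    Real.norm_of_nonneg (h j).le, Real.norm_of_nonneg hy.le]
  ring

/-- The functional equation `f(qy) = (1 - y) f(y)`, which is the recursion `eulerCoeff_succ_mul`
read on coefficients. -/
lemma tsum_eulerCoeff_mul (hq : 1 < q) {y : ℝ} (hy : 0 < y) :
    ∑' j, eulerCoeff q j * (q * y) ^ j = (1 - y) * ∑' j, eulerCoeff q j * y ^ j := by
  have hs := summable_eulerCoeff_mul_pow hq hy
  have hs' := summable_eulerCoeff_mul_pow hq (mul_pos (by linarith) hy : 0 < q * y)
  have h1 : ∀ j, eulerCoeff q (j + 1) * (q * y) ^ (j + 1) =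
      eulerCoeff q (j + 1) * y ^ (j + 1) - y * (eulerCoeff q j * y ^ j) := fun j => by
    have := eulerCoeff_succ_mul hq j
    rw [mul_pow]
    linear_combination y ^ (j + 1) * this
  rw [hs'.tsum_eq_zero_add]
  simp only [h1]
  rw [((summable_nat_add_iff 1).2 hs).tsum_sub (hs.mul_left y), tsum_mul_left, one_sub_mul,
    pow_zero, ← pow_zero y, ← add_sub_assoc, ← hs.tsum_eq_zero_add]

lemma prod_mul_tsum_eulerCoeff (hq : 1 < q) {y : ℝ} (hy : 0 < y) (N : ℕ) :
    (∏ k ∈ Finset.range N, (1 - y * (q ^ (k + 1))⁻¹)) *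
      ∑' j, eulerCoeff q j * (y * (q ^ N)⁻¹) ^ j = ∑' j, eulerCoeff q j * y ^ j := by
  have hq0 : 0 < q := by linarith
  induction N with
  | zero => simp
  | succ N ih =>
    rw [← ih, Finset.prod_range_succ, mul_assoc,
      ← tsum_eulerCoeff_mul hq (y := y * (q ^ (N + 1))⁻¹) (by positivity)]
    have : q * (y * (q ^ (N + 1))⁻¹) = y * (q ^ N)⁻¹ := by
      rw [pow_succ]
      field_simp
    rw [this]

/-- Iterating the functional equation leaves the tail `f(y q^{-N})`, which tends to `f(0) = 1`. -/
lemma tendsto_prod_eulerProduct (hq : 1 < q) {y : ℝ} (hy : 0 < y) :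
    Tendsto (fun N => ∏ k ∈ Finset.range N, (1 - y * (q ^ (k + 1))⁻¹)) atTop
      (𝓝 (∑' j, eulerCoeff q j * y ^ j)) := by
  have hq0 : 0 < q := by linarith
  have h1 : Tendsto (fun N => ∑' j, eulerCoeff q j * (y * (q ^ N)⁻¹) ^ j) atTop
      (𝓝 (∑' j, eulerCoeff q j * (0 : ℝ) ^ j)) := by
    refine tendsto_tsum_of_dominated_convergence
      (bound := fun j => ‖eulerCoeff q j * y ^ j‖) (summable_eulerCoeff_mul_pow hq hy).norm
      (fun j => ?_) (Eventually.of_forall fun N j => ?_)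
    · refine Tendsto.const_mul _ (Tendsto.pow ?_ j)
      have := ((tendsto_pow_atTop_atTop_of_one_lt hq).inv_tendsto_atTop).const_mul y
      simpa using this
    · rw [norm_mul, norm_mul, norm_pow, norm_pow, norm_mul, Real.norm_of_nonneg hy.le]
      gcongr
      rw [norm_inv, Real.norm_of_nonneg (by positivity)]
      exact mul_le_of_le_one_right hy.le (inv_le_one_of_one_le₀ (one_le_pow₀ hq.le))
  have h0 : ∑' j, eulerCoeff q j * (0 : ℝ) ^ j = 1 := by
    rw [tsum_eq_single 0 (fun j hj => by rw [zero_pow hj, mul_zero])]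
    simp [eulerCoeff]
  rw [h0] at h1
  have h2 := (tendsto_const_nhds (x := ∑' j, eulerCoeff q j * y ^ j)).div h1 one_ne_zero
  rw [div_one] at h2
  refine h2.congr' ?_
  filter_upwards [h1.eventually_ne one_ne_zero] with N hN
  rw [Pi.div_apply, ← prod_mul_tsum_eulerCoeff hq hy N, mul_div_cancel_right₀ _ hN]

lemma multipliable_eulerProduct (hq : 1 < q) (y : ℝ) :
    Multipliable fun k : ℕ => 1 - y * (q ^ (k + 1))⁻¹ := by
  simp only [sub_eq_add_neg]
  refine multipliable_one_add_of_summable ?_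
  have hq0 : 0 < q := by linarith
  have hs : Summable fun k : ℕ => |y| * q⁻¹ * q⁻¹ ^ k :=
    (summable_geometric_of_lt_one (by positivity) (inv_lt_one_of_one_lt₀ hq)).mul_left _
  refine hs.congr fun k => ?_
  rw [norm_neg, norm_mul, norm_inv, Real.norm_of_nonneg (by positivity : 0 ≤ q ^ (k + 1)),
    Real.norm_eq_abs, pow_succ, mul_inv, inv_pow]
  ring

/-- Euler's identity for the product `∏ (1 - y q^{-i})`, `i ≥ 1`. -/
lemma tendsto_sum_eulerCoeff (hq : 1 < q) {y : ℝ} (hy : 0 < y) :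
    Tendsto (fun J => ∑ j ∈ Finset.range J, eulerCoeff q j * y ^ j) atTop
      (𝓝 (∏' k : ℕ, (1 - y * (q ^ (k + 1))⁻¹))) := by
  have h1 := (multipliable_eulerProduct hq y).hasProd.tendsto_prod_nat
  rw [tendsto_nhds_unique h1 (tendsto_prod_eulerProduct hq hy)]
  exact (summable_eulerCoeff_mul_pow hq hy).hasSum.tendsto_sum_nat

end Euler

/-! ### Counting linearly independent tuples -/

section Tuples

variable {k V : Type*} [Field k] [Finite k] [AddCommGroup V] [Module k V] [Finite V]

lemma natCard_linearIndependent (j : ℕ) :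
    (Nat.card {g : Fin j → V // LinearIndependent k g} : ℝ) =
      ∏ i ∈ Finset.range j, ((Nat.card k : ℝ) ^ Module.finrank k V - (Nat.card k : ℝ) ^ i) := by
  have := Fintype.ofFinite k
  rw [Nat.card_eq_fintype_card (α := k), Finset.prod_range]
  by_cases hj : j ≤ Module.finrank k V
  · rw [card_linearIndependent hj, Nat.cast_prod]
    refine Finset.prod_congr rfl fun i _ => ?_
    rw [Nat.cast_sub (Nat.pow_le_pow_right Fintype.card_pos (i.2.le.trans hj))]
    push_cast
    rfl
  · push Not at hj
    rw [Finset.prod_eq_zero (Finset.mem_univ (⟨Module.finrank k V, hj⟩ : Fin j)) (sub_self _)]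
    have : IsEmpty {g : Fin j → V // LinearIndependent k g} := by
      refine ⟨fun g => ?_⟩
      have := g.2.fintype_card_le_finrank
      rw [Fintype.card_fin] at this
      omega
    simp

lemma natCard_linearIndependent_mem (U : Submodule k V) (j : ℕ) :
    (Nat.card {g : Fin j → V // LinearIndependent k g ∧ ∀ i, g i ∈ U} : ℝ) =
      ∏ i ∈ Finset.range j, ((Nat.card k : ℝ) ^ Module.finrank k U - (Nat.card k : ℝ) ^ i) := by
  rw [← natCard_linearIndependent]
  congr 1
  refine Nat.card_congr
    { toFun := fun g => ⟨fun i => ⟨g.1 i, g.2.2 i⟩, ?_⟩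
      invFun := fun g => ⟨fun i => g.1 i, ?_, fun i => (g.1 i).2⟩
      left_inv := fun g => rfl
      right_inv := fun g => rfl }
  · exact LinearIndependent.of_comp U.subtype g.2.1
  · exact g.2.map' U.subtype U.ker_subtype

end Tuples

/-! ### Random matrices as weighted sums, and generating families -/

section MatrixProb

open Classical in
/-- The probability of `S` for a random matrix with independent entries of weights `m`. -/
noncomputable def matrixProb {R : Type*} [Fintype R] (m : R → ℝ) {n k : ℕ}
    (S : Matrix (Fin n) (Fin k) R → Prop) : ℝ :=
  ∑ M : Matrix (Fin n) (Fin k) R, (∏ i, ∏ j, m (M i j)) * if S M then 1 else 0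

lemma IsIIDMatrix.measureReal_eq {R : Type*} [Fintype R] [MeasurableSpace R]
    [MeasurableSingletonClass R] {Ω : Type*} [MeasurableSpace Ω] {n k : ℕ}
    {X : Ω → Matrix (Fin n) (Fin k) R} {μ : Measure R} [IsProbabilityMeasure μ] {P : Measure Ω}
    [IsProbabilityMeasure P] (hX : IsIIDMatrix X μ P) (S : Matrix (Fin n) (Fin k) R → Prop) :
    P.real {ω | S (X ω)} = matrixProb (fun x => μ.real {x}) S := by
  classical
  have hae : ∀ p : Fin n × Fin k, AEMeasurable (fun ω => X ω p.1 p.2) P :=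
    fun p => (hX.law p.1 p.2).aemeasurable
  have hmap : P.map (fun ω (p : Fin n × Fin k) => X ω p.1 p.2) = Measure.pi fun _ => μ := by
    rw [(iIndepFun_iff_map_fun_eq_pi_map hae).1 hX.indep]
    congr 1
    funext p
    exact (hX.law p.1 p.2).map_eq
  have hae' : AEMeasurable (fun ω (p : Fin n × Fin k) => X ω p.1 p.2) P := aemeasurable_pi_lambda _ hae
  let T : Set (Fin n × Fin k → R) := {f | S (Matrix.of fun i j => f (i, j))}
  have h1 : P.real {ω | S (X ω)} = (Measure.pi fun _ : Fin n × Fin k => μ).real T := by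
    rw [← hmap, map_measureReal_apply_of_aemeasurable hae' (Set.toFinite T).measurableSet]
    rfl
  have h2 : T = (Finset.univ.filter fun f => f ∈ T : Finset (Fin n × Fin k → R)) := by
    ext f
    simp
  rw [h1, h2, ← sum_measureReal_singleton, Finset.sum_filter, matrixProb]
  refine Fintype.sum_equiv (Equiv.curry (Fin n) (Fin k) R) _ _ fun f => ?_
  have h3 : (Measure.pi fun _ : Fin n × Fin k => μ).real {f} = ∏ i, ∏ j, μ.real {f (i, j)} := by
    rw [measureReal_def, Measure.pi_singleton, ENNReal.toReal_prod, Fintype.prod_prod_type]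
    rfl
  rw [h3, mul_ite, mul_one, mul_zero]
  rfl

lemma IsNondegenerateLaw.isNondegenerateWeight {R : Type*} [CommRing R] [Fintype R]
    [MeasurableSpace R] [MeasurableSingletonClass R] {μ : Measure R} [IsProbabilityMeasure μ]
    (hμ : IsNondegenerateLaw μ) : IsNondegenerateWeight fun x => μ.real {x} := by
  have hae : ∀ p : R → Prop, (¬ ∀ᵐ x ∂μ, p x) → ∃ x, μ.real {x} ≠ 0 ∧ ¬ p x := by
    intro p hp
    by_contra! h
    refine hp ?_
    rw [ae_iff_of_countable]
    intro x hx
    refine h x ?_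
    rw [measureReal_def, ENNReal.toReal_ne_zero]
    exact ⟨hx, measure_ne_top _ _⟩
  refine ⟨fun x => measureReal_nonneg, ?_, fun I hI b => ?_, fun S hS w b => ?_⟩
  · rw [sum_measureReal_singleton, Finset.coe_univ, probReal_univ]
  · obtain ⟨x, hx, h⟩ := hae _ (hμ.ideal I hI b)
    exact ⟨x, hx, fun hmem => h ⟨x - b, hmem, by ring⟩⟩
  · obtain ⟨x, hx, h⟩ := hae _ (hμ.subring S hS w b)
    exact ⟨x, hx, fun s hs he => h ⟨s, hs, he⟩⟩

lemma isProbabilityMeasure_uniformOn_univ {R : Type*} [Finite R] [Nonempty R] [MeasurableSpace R]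
    [MeasurableSingletonClass R] : IsProbabilityMeasure (uniformOn (Set.univ : Set R)) :=
  isProbabilityMeasure_uniformOn Set.finite_univ Set.univ_nonempty

lemma isNondegenerateLaw_uniformOn_univ {R : Type*} [CommRing R] [Finite R] [MeasurableSpace R]
    [MeasurableSingletonClass R] : IsNondegenerateLaw (uniformOn (Set.univ : Set R)) := by
  have hall : ∀ p : R → Prop, (∀ᵐ x ∂uniformOn (Set.univ : Set R), p x) → ∀ x, p x := by
    intro p hp x
    rw [ae_iff_of_countable] at hp
    refine hp x fun h => ?_
    rw [uniformOn_eq_zero_iff Set.finite_univ] at h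
    simp at h
  refine ⟨fun I hI b h => ?_, fun S hS w b h => ?_⟩
  · refine hI (Ideal.eq_top_iff_one I |>.2 ?_)
    obtain ⟨a, ha, h1⟩ := hall _ h (b + 1)
    rwa [add_left_cancel h1]
  · refine hS ((Subring.eq_top_iff' S).2 fun x => ?_)
    obtain ⟨s, hs, h1⟩ := hall _ h (b + w * x)
    have h2 := add_left_cancel h1
    rw [Units.mul_right_inj] at h2
    rwa [h2]

variable {R : Type*} [CommRing R] [Fintype R] {m : R → ℝ}

omit [Fintype R] in
lemma range_mulVecLin_le_ker_iff {B : Type*} [AddCommGroup B] [Module R B] {n k : ℕ}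
    {v : Fin n → B} {M : Matrix (Fin n) (Fin k) R} :
    LinearMap.range M.mulVecLin ≤ LinearMap.ker (Fintype.linearCombination R v) ↔
      ∀ j, ∑ i, M i j • v i = 0 := by
  rw [LinearMap.range_le_ker_iff]
  constructor
  · intro h j
    have := LinearMap.congr_fun h (Pi.single j 1)
    simpa [Fintype.linearCombination_apply] using this
  · intro h
    ext j
    simpa [Fintype.linearCombination_apply] using h j

/-- The columns are independent, and each must satisfy the relation given by `v`. -/
lemma matrixProb_range_le_ker {B : Type*} [AddCommGroup B] [Module R B] (m : R → ℝ) {n k : ℕ}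
    (v : Fin n → B) :
    matrixProb m (fun M : Matrix (Fin n) (Fin k) R =>
      LinearMap.range M.mulVecLin ≤ LinearMap.ker (Fintype.linearCombination R v)) =
      relationProb m v ^ k := by
  classical
  rw [relationProb, Fintype.sum_pow, matrixProb]
  refine Fintype.sum_equiv (Equiv.piComm _) _ _ fun M => ?_
  rw [Finset.prod_mul_distrib, Finset.prod_comm, Finset.prod_ite_zero, Finset.prod_const_one]
  simp only [Finset.mem_univ, true_imp_iff]
  exact congrArg₂ (· * ·) rfl (if_congr range_mulVecLin_le_ker_iff rfl rfl)

/-- Isomorphisms from a quotient of `R^n` to `A` are the generating families of `A` with the given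
module of relations. -/
noncomputable def generatingFamilyEquiv {A : Type*} [AddCommGroup A] [Module R A] {n : ℕ}
    (W : Submodule R (Fin n → R)) :
    {v : Fin n → A // Submodule.span R (Set.range v) = ⊤ ∧
      W = LinearMap.ker (Fintype.linearCombination R v)} ≃ (((Fin n → R) ⧸ W) ≃ₗ[R] A) where
  toFun v := (Submodule.quotEquivOfEq _ _ v.2.2).trans
    (LinearMap.quotKerEquivOfSurjective _ (surjective_linearCombination_iff.2 v.2.1))
  invFun e := ⟨fun i => e (W.mkQ (Pi.single i 1)), by
    have h : Fintype.linearCombination R (fun i => e (W.mkQ (Pi.single i 1))) =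
        e.toLinearMap ∘ₗ W.mkQ := by
      ext i
      simp
    rw [← surjective_linearCombination_iff, h]
    refine ⟨e.surjective.comp W.mkQ_surjective, ?_⟩
    rw [LinearEquiv.ker_comp, Submodule.ker_mkQ]⟩
  left_inv v := by
    apply Subtype.ext
    funext i
    have : ((Submodule.quotEquivOfEq _ _ v.2.2).trans
      (LinearMap.quotKerEquivOfSurjective _ (surjective_linearCombination_iff.2 v.2.1)))
        (W.mkQ (Pi.single i 1)) = Fintype.linearCombination R v.1 (Pi.single i 1) := rfl
    simp only [this, Fintype.linearCombination_apply_single, one_smul]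
  right_inv e := by
    apply LinearEquiv.toLinearMap_injective
    apply Submodule.linearMap_qext
    ext i
    change Fintype.linearCombination R (fun i => e (W.mkQ (Pi.single i 1))) (Pi.single i 1) = _
    rw [Fintype.linearCombination_apply_single, one_smul]
    rfl

omit [Fintype R] in
open Classical in
-- The isomorphisms from the quotient to `A` are either absent or permuted simply transitively by
-- the automorphisms of `A`.
lemma card_aut_mul_ite {A : Type*} [AddCommGroup A] [Module R A] [Fintype A] {n : ℕ}
    (W : Submodule R (Fin n → R)) :
    (Nat.card (A ≃ₗ[R] A) : ℝ) * (if Nonempty (((Fin n → R) ⧸ W) ≃ₗ[R] A) then 1 else 0) =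
      ∑ v : Fin n → A with Submodule.span R (Set.range v) = ⊤,
        if W = LinearMap.ker (Fintype.linearCombination R v) then 1 else 0 := by
  rw [Finset.sum_boole, Finset.filter_filter, ← Fintype.card_subtype, ← Nat.card_eq_fintype_card,
    Nat.card_congr (generatingFamilyEquiv W)]
  split_ifs with h
  · obtain ⟨e⟩ := h
    rw [mul_one, Nat.card_congr
      { toFun := fun f : A ≃ₗ[R] A => e.trans f
        invFun := fun f => e.symm.trans f
        left_inv := fun f => by ext; simp
        right_inv := fun f => by ext; simp }]
  · have : IsEmpty (((Fin n → R) ⧸ W) ≃ₗ[R] A) := not_nonempty_iff.1 h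
    simp

end MatrixProb

/-! ### Inclusion-exclusion over tuples of functionals on a submodule -/

section Tuples

variable {R : Type*} [CommRing R] [IsLocalRing R] {E : Type*} [AddCommGroup E] [Module R E]

/-- The common kernel of a tuple of functionals on `K`, as a submodule of the ambient module. -/
noncomputable def tupleKernel {K : Submodule R E} {j : ℕ} (g : Fin j → K →ₗ[R] IsLocalRing.ResidueField R) :
    Submodule R E :=
  (LinearMap.ker (LinearMap.pi g)).map K.subtype

lemma mem_tupleKernel_iff {K : Submodule R E} {j : ℕ}
    {g : Fin j → K →ₗ[R] IsLocalRing.ResidueField R} {x : E} :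
    x ∈ tupleKernel g ↔ ∃ h : x ∈ K, ∀ i, g i ⟨x, h⟩ = 0 := by
  simp only [tupleKernel, Submodule.mem_map, LinearMap.mem_ker]
  constructor
  · rintro ⟨y, hy, rfl⟩
    exact ⟨y.2, fun i => congrFun hy i⟩
  · rintro ⟨h, hg⟩
    exact ⟨⟨x, h⟩, funext hg, rfl⟩

lemma le_tupleKernel_iff {K W : Submodule R E} {j : ℕ}
    {g : Fin j → K →ₗ[R] IsLocalRing.ResidueField R} :
    W ≤ tupleKernel g ↔ W ≤ K ∧ ∀ i, g i ∈ residueAnnihilator (W.comap K.subtype) := by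
  constructor
  · intro h
    refine ⟨fun x hx => (mem_tupleKernel_iff.1 (h hx)).1, fun i x hx => ?_⟩
    exact (mem_tupleKernel_iff.1 (h hx)).2 i
  · rintro ⟨h, hg⟩ x hx
    exact mem_tupleKernel_iff.2 ⟨h hx, fun i => hg i ⟨x, h hx⟩ hx⟩

variable [Finite R] [Finite E]

/-- The linearly independent tuples of functionals on `K` with values in the residue field. -/
noncomputable def linIndepTuples (K : Submodule R E) (j : ℕ) :
    Finset (Fin j → K →ₗ[R] IsLocalRing.ResidueField R) :=
  (Set.toFinite {g | LinearIndependent (IsLocalRing.ResidueField R) g}).toFinset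

lemma mem_linIndepTuples {K : Submodule R E} {j : ℕ}
    {g : Fin j → K →ₗ[R] IsLocalRing.ResidueField R} :
    g ∈ linIndepTuples K j ↔ LinearIndependent (IsLocalRing.ResidueField R) g := by
  simp [linIndepTuples]

lemma one_lt_card_residueField (R : Type*) [CommRing R] [IsLocalRing R] [Finite R] :
    (1 : ℝ) < Nat.card (IsLocalRing.ResidueField R) :=
  Nat.one_lt_cast.2 Finite.one_lt_card

lemma card_linIndepTuples (K : Submodule R E) (j : ℕ) :
    ((linIndepTuples K j).card : ℝ) = ∏ i ∈ Finset.range j,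
      ((Nat.card (IsLocalRing.ResidueField R) : ℝ) ^ Module.finrank (IsLocalRing.ResidueField R)
        (K →ₗ[R] IsLocalRing.ResidueField R) - (Nat.card (IsLocalRing.ResidueField R) : ℝ) ^ i) := by
  rw [← natCard_linearIndependent, ← Nat.card_eq_finsetCard]
  congr 1
  exact Nat.card_congr (Equiv.subtypeEquivRight fun g => mem_linIndepTuples)

open Classical in
lemma sum_linIndepTuples_ite {K W : Submodule R E} (hW : W ≤ K) (j : ℕ) :
    ∑ g ∈ linIndepTuples K j, (if W ≤ tupleKernel g then (1 : ℝ) else 0) =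
      ∏ i ∈ Finset.range j, ((Nat.card (IsLocalRing.ResidueField R) : ℝ) ^
        Module.finrank (IsLocalRing.ResidueField R) (residueAnnihilator (W.comap K.subtype)) -
          (Nat.card (IsLocalRing.ResidueField R) : ℝ) ^ i) := by
  rw [Finset.sum_boole, ← natCard_linearIndependent_mem, ← Nat.card_eq_finsetCard]
  congr 1
  refine Nat.card_congr (Equiv.subtypeEquivRight fun g => ?_)
  rw [Finset.mem_filter, mem_linIndepTuples, le_tupleKernel_iff]
  simp [hW]

open Classical in
-- The tuples on `K` that vanish on `W` are those with entries in `residueAnnihilator`, whose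
-- dimension is zero exactly when `W = K`.
lemma bonferroni_submodule (K W : Submodule R E) (J : ℕ) :
    0 ≤ (-1) ^ J * (∑ j ∈ Finset.range (J + 1),
      eulerCoeff (Nat.card (IsLocalRing.ResidueField R)) j *
        ∑ g ∈ linIndepTuples K j, (if W ≤ tupleKernel g then (1 : ℝ) else 0) -
          if W = K then 1 else 0) := by
  by_cases hW : W ≤ K
  · simp only [sum_linIndepTuples_ite hW]
    have h : W = K ↔ Module.finrank (IsLocalRing.ResidueField R)
        (residueAnnihilator (W.comap K.subtype)) = 0 := by
      rw [Submodule.finrank_eq_zero, residueAnnihilator_eq_bot_iff, Submodule.comap_subtype_eq_top]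
      exact ⟨fun h => h.ge, fun h => le_antisymm hW h⟩
    rw [if_congr h rfl rfl]
    exact bonferroni_nonneg (one_lt_card_residueField R) _ J
  · have h1 : ∀ j, ∑ g ∈ linIndepTuples K j, (if W ≤ tupleKernel g then (1 : ℝ) else 0) = 0 :=
      fun j => Finset.sum_eq_zero fun g _ => if_neg fun h => hW (le_tupleKernel_iff.1 h).1
    rw [if_neg fun h => hW h.le]
    simp [h1]

lemma card_quotient_tupleKernel {K : Submodule R E} {j : ℕ}
    {g : Fin j → K →ₗ[R] IsLocalRing.ResidueField R} (hg : g ∈ linIndepTuples K j) :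
    Nat.card (E ⧸ tupleKernel g) =
      Nat.card (E ⧸ K) * Nat.card (IsLocalRing.ResidueField R) ^ j := by
  have hs := surjective_pi_of_linearIndependent (mem_linIndepTuples.1 hg)
  have h1 := Submodule.card_eq_card_quotient_mul_card (tupleKernel g)
  have h2 := Submodule.card_eq_card_quotient_mul_card K
  have h3 := Submodule.card_eq_card_quotient_mul_card (LinearMap.ker (LinearMap.pi g))
  have h4 : Nat.card (tupleKernel g) = Nat.card (LinearMap.ker (LinearMap.pi g)) :=
    (Nat.card_congr (Submodule.equivMapOfInjective _ K.injective_subtype _).toEquiv).symm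
  have h5 : Nat.card (K ⧸ LinearMap.ker (LinearMap.pi g)) =
      Nat.card (IsLocalRing.ResidueField R) ^ j := by
    rw [Nat.card_congr (LinearMap.quotKerEquivOfSurjective _ hs).toEquiv, Nat.card_fun,
      Nat.card_eq_fintype_card (α := Fin j), Fintype.card_fin]
  have h6 : 0 < Nat.card (tupleKernel g) := Nat.card_pos
  rw [h4] at h1 h6
  rw [h5] at h3
  refine Nat.eq_of_mul_eq_mul_right h6 ?_
  nlinarith [h1, h2, h3]

end Tuples

/-! ### Tuple kernels as relation modules of finitely many modules -/

section Covering

variable {R : Type*} [CommRing R] [IsLocalRing R] [Finite R]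
  {A : Type*} [AddCommGroup A] [Module R A] [Fintype A]

/-- The relations among the members of a family. -/
abbrev relationModule (R : Type*) [CommRing R] {A : Type*} [AddCommGroup A] [Module R A] {n : ℕ}
    (v : Fin n → A) : Submodule R (Fin n → R) :=
  LinearMap.ker (Fintype.linearCombination R v)

open Classical in
/-- A family together with functionals on its relations, as one function on the free module. -/
noncomputable def markedValue {n j : ℕ} (v : Fin n → A)
    (g : Fin j → relationModule R v →ₗ[R] IsLocalRing.ResidueField R) (x : Fin n → R) :
    A × (Fin j → IsLocalRing.ResidueField R) :=
  (Fintype.linearCombination R v x,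
    fun i => if h : x ∈ relationModule R v then g i ⟨x, h⟩ else 0)

omit [Finite R] [Fintype A] in
lemma markedValue_eq_of_sub_mem {n j : ℕ} {v : Fin n → A}
    {g : Fin j → relationModule R v →ₗ[R] IsLocalRing.ResidueField R} {x y : Fin n → R}
    (h : x - y ∈ tupleKernel g) : markedValue v g x = markedValue v g y := by
  obtain ⟨hK, hg⟩ := mem_tupleKernel_iff.1 h
  have hxy : Fintype.linearCombination R v x = Fintype.linearCombination R v y := by
    rw [← sub_eq_zero, ← map_sub]
    exact hK
  refine Prod.ext hxy (funext fun i => ?_)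
  simp only [markedValue]
  by_cases hx : x ∈ relationModule R v
  · have hy : y ∈ relationModule R v := LinearMap.mem_ker.2 (hxy ▸ LinearMap.mem_ker.1 hx)
    rw [dif_pos hx, dif_pos hy, ← sub_eq_zero, ← map_sub]
    exact hg i
  · have hy : y ∉ relationModule R v := fun hy => hx (LinearMap.mem_ker.2 (hxy ▸ LinearMap.mem_ker.1 hy))
    rw [dif_neg hx, dif_neg hy]

omit [Finite R] [Fintype A] in
-- The values on the standard basis give `v`, hence its relation module, on which the second
-- component is `g`.
lemma markedValue_injective {n j : ℕ} :
    Function.Injective fun p : Σ v : Fin n → A,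
      (Fin j → relationModule R v →ₗ[R] IsLocalRing.ResidueField R) => markedValue p.1 p.2 := by
  rintro ⟨v, g⟩ ⟨v', g'⟩ h
  have h1 : ∀ x, markedValue v g x = markedValue v' g' x := fun x => congrFun h x
  have hv : v = v' := by
    funext i
    have := congrArg Prod.fst (h1 (Pi.single i 1))
    simpa [markedValue, Fintype.linearCombination_apply] using this
  subst hv
  have hg : g = g' := by
    funext i
    ext x
    have := congrFun (congrArg Prod.snd (h1 x)) i
    simpa [markedValue] using this
  rw [hg]

omit [Fintype A] in
/-- The data from which a family and functionals on its relations can be recovered. -/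
lemma exists_marking {n j N : ℕ} {v : Fin n → A} (hv : Submodule.span R (Set.range v) = ⊤)
    {g : Fin j → relationModule R v →ₗ[R] IsLocalRing.ResidueField R}
    (hg : g ∈ linIndepTuples (relationModule R v) j)
    (hN : N = Nat.card A * Nat.card (IsLocalRing.ResidueField R) ^ j) :
    ∃ (L : Submodule R (Fin N → R)) (w : Fin n → (Fin N → R) ⧸ L)
      (φ : (Fin N → R) ⧸ L → A × (Fin j → IsLocalRing.ResidueField R)),
      Submodule.span R (Set.range w) = ⊤ ∧ tupleKernel g = relationModule R w ∧
        ∀ x, φ (Fintype.linearCombination R w x) = markedValue v g x := by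
  have hcard : Nat.card ((Fin n → R) ⧸ tupleKernel g) = N := by
    rw [card_quotient_tupleKernel hg, hN, Nat.card_congr
      (LinearMap.quotKerEquivOfSurjective _ (surjective_linearCombination_iff.2 hv)).toEquiv]
  have := Finite.of_surjective _ (tupleKernel g).mkQ_surjective
  -- All `N` elements of the quotient serve as generators, which makes it a quotient of `R^N` with
  -- `N` independent of `n`.
  let b : Fin N ≃ (Fin n → R) ⧸ tupleKernel g := (Finite.equivFinOfCardEq hcard).symm
  have hb : Function.Surjective (Fintype.linearCombination R b) := fun y =>
    ⟨Pi.single (b.symm y) 1, by simp [Fintype.linearCombination_apply_single]⟩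
  let e := (LinearMap.quotKerEquivOfSurjective _ hb).symm
  obtain ⟨w, hw, hker⟩ := (generatingFamilyEquiv (tupleKernel g)).symm e
  have hsurj := surjective_linearCombination_iff.2 hw
  refine ⟨_, w, fun y => markedValue v g (Function.surjInv hsurj y), hw, hker, fun x => ?_⟩
  refine markedValue_eq_of_sub_mem ?_
  refine hker.ge ?_
  rw [LinearMap.mem_ker, map_sub, Function.surjInv_eq hsurj, sub_self]

open Classical in
/-- Sums over pairs of a generating family and independent functionals on its relations are
bounded by sums over generating families of finitely many modules. -/
lemma sum_tupleKernel_le {j N n : ℕ}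
    (hN : N = Nat.card A * Nat.card (IsLocalRing.ResidueField R) ^ j)
    [Fintype (Submodule R (Fin N → R))]
    [∀ L : Submodule R (Fin N → R), Fintype ((Fin N → R) ⧸ L)]
    {t : Submodule R (Fin n → R) → ℝ} (ht : ∀ W, 0 ≤ t W) :
    ∑ v : Fin n → A with Submodule.span R (Set.range v) = ⊤,
      ∑ g ∈ linIndepTuples (relationModule R v) j, t (tupleKernel g) ≤
    ∑ L : Submodule R (Fin N → R),
      (Nat.card ((Fin N → R) ⧸ L → A × (Fin j → IsLocalRing.ResidueField R)) : ℝ) *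
        ∑ w : Fin n → (Fin N → R) ⧸ L with Submodule.span R (Set.range w) = ⊤,
          t (relationModule R w) := by
  have := fun L : Submodule R (Fin N → R) =>
    Fintype.ofFinite ((Fin N → R) ⧸ L → A × (Fin j → IsLocalRing.ResidueField R))
  let X : Finset (Σ v : Fin n → A,
      (Fin j → relationModule R v →ₗ[R] IsLocalRing.ResidueField R)) :=
    (Finset.univ.filter fun v : Fin n → A => Submodule.span R (Set.range v) = ⊤).sigma
      fun v => linIndepTuples (relationModule R v) j
  let Y : Finset (Σ L : Submodule R (Fin N → R), (Fin n → (Fin N → R) ⧸ L) ×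
      ((Fin N → R) ⧸ L → A × (Fin j → IsLocalRing.ResidueField R))) :=
    Finset.univ.sigma fun L =>
      (Finset.univ.filter fun w => Submodule.span R (Set.range w) = ⊤) ×ˢ Finset.univ
  have hX : ∀ p : X, ∃ y ∈ Y, tupleKernel p.1.2 = relationModule R y.2.1 ∧
      ∀ x, y.2.2 (Fintype.linearCombination R y.2.1 x) = markedValue p.1.1 p.1.2 x := by
    rintro ⟨⟨v, g⟩, hp⟩
    obtain ⟨hv, hg⟩ := Finset.mem_sigma.1 hp
    obtain ⟨L, w, φ, hw, hker, hφ⟩ := exists_marking (Finset.mem_filter.1 hv).2 hg hN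
    refine ⟨⟨L, w, φ⟩, ?_, hker, hφ⟩
    simp [Y, hw]
  choose f hfY hker hφ using hX
  -- The set map `φ` (not linear) in the data is what restores `(v, g)`; the number of choices for
  -- it is the constant multiplicity in the bound.
  have hinj : Function.Injective f := by
    intro p p' hpp
    refine Subtype.ext (markedValue_injective (funext fun x => ?_))
    simp only
    rw [← hφ p x, ← hφ p' x, hpp]
  calc _ = ∑ p ∈ X, t (tupleKernel p.2) := by rw [Finset.sum_sigma]
    _ = ∑ p : X, t (relationModule R (f p).2.1) := by
        rw [← Finset.sum_coe_sort]
        exact Finset.sum_congr rfl fun p _ => by rw [hker]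
    _ = ∑ y ∈ Finset.univ.map ⟨f, hinj⟩, t (relationModule R y.2.1) := by
        rw [Finset.sum_map]
        rfl
    _ ≤ ∑ y ∈ Y, t (relationModule R y.2.1) := by
        refine Finset.sum_le_sum_of_subset_of_nonneg (fun y hy => ?_) fun y _ _ => ht _
        obtain ⟨p, -, rfl⟩ := Finset.mem_map.1 hy
        exact hfY p
    _ = _ := by
        rw [Finset.sum_sigma]
        refine Finset.sum_congr rfl fun L _ => ?_
        rw [Finset.sum_product_right]
        change ∑ _φ : (Fin N → R) ⧸ L → A × (Fin j → IsLocalRing.ResidueField R),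
          ∑ w : Fin n → (Fin N → R) ⧸ L with Submodule.span R (Set.range w) = ⊤,
            t (relationModule R w) = _
        rw [Finset.sum_const, nsmul_eq_mul, Finset.card_univ, Nat.card_eq_fintype_card]

end Covering

/-! ### Limits of tuple sums and of the cokernel distribution -/

section TupleSums

variable {R : Type*} [CommRing R] [IsLocalRing R] [Fintype R] {m : R → ℝ}

omit [IsLocalRing R] [Fintype R] in
lemma card_quotient_relationModule {B : Type*} [AddCommGroup B] [Module R B] {n : ℕ}
    {w : Fin n → B} (hw : Submodule.span R (Set.range w) = ⊤) :
    Nat.card ((Fin n → R) ⧸ relationModule R w) = Nat.card B :=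
  Nat.card_congr
    (LinearMap.quotKerEquivOfSurjective _ (surjective_linearCombination_iff.2 hw)).toEquiv

open Classical in
-- The number of tuples grows with `n`, so convergence of individual terms is not enough; the
-- covering reduces the sum to finitely many summed moment errors.
lemma tendsto_sum_tupleKernel_error (hm : IsNondegenerateWeight m) (u j : ℕ)
    (A : Type*) [AddCommGroup A] [Module R A] [Fintype A] :
    Tendsto (fun n : ℕ => ∑ v : Fin n → A with Submodule.span R (Set.range v) = ⊤,
      ∑ g ∈ linIndepTuples (relationModule R v) j,
        |matrixProb m (fun M : Matrix (Fin n) (Fin (n + u)) R =>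
          LinearMap.range M.mulVecLin ≤ tupleKernel g) -
          (1 / (Nat.card ((Fin n → R) ⧸ tupleKernel g) : ℝ)) ^ (n + u)|) atTop (𝓝 0) := by
  set N := Nat.card A * Nat.card (IsLocalRing.ResidueField R) ^ j with hN
  have := Fintype.ofFinite (Submodule R (Fin N → R))
  have := fun L : Submodule R (Fin N → R) => Fintype.ofFinite ((Fin N → R) ⧸ L)
  have hlim := tendsto_finsetSum (Finset.univ : Finset (Submodule R (Fin N → R))) fun L _ =>
    (tendsto_sum_abs_relationProb_sub hm u ((Fin N → R) ⧸ L)).const_mul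
      (Nat.card ((Fin N → R) ⧸ L → A × (Fin j → IsLocalRing.ResidueField R)) : ℝ)
  simp only [mul_zero, Finset.sum_const_zero] at hlim
  refine squeeze_zero (fun n => Finset.sum_nonneg fun v _ => Finset.sum_nonneg fun g _ =>
    abs_nonneg _) (fun n => ?_) hlim
  refine (sum_tupleKernel_le hN (t := fun W => |matrixProb m
    (fun M : Matrix (Fin n) (Fin (n + u)) R => LinearMap.range M.mulVecLin ≤ W) -
      (1 / (Nat.card ((Fin n → R) ⧸ W) : ℝ)) ^ (n + u)|) fun W => abs_nonneg _).trans ?_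
  gcongr with L
  rw [Finset.sum_filter]
  refine Finset.sum_le_sum fun w _ => ?_
  split_ifs with hw
  · rw [matrixProb_range_le_ker, card_quotient_relationModule hw]
  · exact abs_nonneg _

open Classical in
-- Each family that fails to generate contributes exactly `|A|^{-n}` to the moment error with `u =
-- 0`.
lemma tendsto_card_span_eq_top (hm : IsNondegenerateWeight m)
    (A : Type*) [AddCommGroup A] [Module R A] [Fintype A] :
    Tendsto (fun n : ℕ => ((Finset.univ.filter fun v : Fin n → A =>
      Submodule.span R (Set.range v) = ⊤).card : ℝ) * (1 / (Nat.card A : ℝ)) ^ n)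
      atTop (𝓝 1) := by
  have h0 := tendsto_sum_abs_relationProb_sub hm 0 A
  have hN : (0 : ℝ) < Nat.card A := Nat.cast_pos.2 Nat.card_pos
  have h1 : ∀ n : ℕ, (1 : ℝ) = (((Finset.univ.filter fun v : Fin n → A =>
      Submodule.span R (Set.range v) = ⊤).card : ℝ) + (Finset.univ.filter fun v : Fin n → A =>
      ¬ Submodule.span R (Set.range v) = ⊤).card) * (1 / (Nat.card A : ℝ)) ^ n := by
    intro n
    rw [← Nat.cast_add, Finset.card_filter_add_card_filter_not, Finset.card_univ,
      Fintype.card_pi_const, ← Nat.card_eq_fintype_card, Nat.cast_pow, ← mul_pow,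
      mul_one_div_cancel hN.ne', one_pow]
  have h2 : Tendsto (fun n : ℕ => ((Finset.univ.filter fun v : Fin n → A =>
      ¬ Submodule.span R (Set.range v) = ⊤).card : ℝ) * (1 / (Nat.card A : ℝ)) ^ n)
      atTop (𝓝 0) := by
    refine squeeze_zero (fun n => by positivity) (fun n => ?_) h0
    rw [← nsmul_eq_mul, ← Finset.sum_const, Finset.sum_filter]
    refine Finset.sum_le_sum fun v _ => ?_
    split_ifs with h
    · exact abs_nonneg _
    · rw [zero_sub, abs_neg, add_zero]
      exact le_abs_self _
  have h3 := h2.const_sub 1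
  rw [sub_zero] at h3
  refine h3.congr fun n => ?_
  linear_combination h1 n

open Classical in
/-- The sum over generating families and independent functionals of the probability that the
columns satisfy the corresponding relations. -/
noncomputable def tupleSum (m : R → ℝ) (A : Type*) [AddCommGroup A] [Module R A] [Fintype A]
    (u j n : ℕ) : ℝ :=
  ∑ v : Fin n → A with Submodule.span R (Set.range v) = ⊤,
    ∑ g ∈ linIndepTuples (relationModule R v) j,
      matrixProb m (fun M : Matrix (Fin n) (Fin (n + u)) R =>
        LinearMap.range M.mulVecLin ≤ tupleKernel g)

lemma tendsto_tupleSum (hm : IsNondegenerateWeight m) (u j : ℕ)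
    (A : Type*) [AddCommGroup A] [Module R A] [Fintype A] :
    Tendsto (tupleSum m A u j) atTop (𝓝 ((1 / (Nat.card A : ℝ)) ^ u *
      ((Nat.card (IsLocalRing.ResidueField R) : ℝ) ^ (-(presentationDefect R A + u))) ^ j)) := by
  classical
  set q : ℝ := (Nat.card (IsLocalRing.ResidueField R) : ℝ) with hqdef
  set d := presentationDefect R A
  have hq : 1 < q := one_lt_card_residueField R
  have hq0 : q ≠ 0 := by linarith
  have hmain : ∀ n : ℕ, ∑ v : Fin n → A with Submodule.span R (Set.range v) = ⊤,
      ∑ g ∈ linIndepTuples (relationModule R v) j,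
        (1 / (Nat.card ((Fin n → R) ⧸ tupleKernel g) : ℝ)) ^ (n + u) =
      ((Finset.univ.filter fun v : Fin n → A => Submodule.span R (Set.range v) = ⊤).card *
        (1 / (Nat.card A : ℝ)) ^ n) * ((1 / (Nat.card A : ℝ)) ^ u *
          ∏ i ∈ Finset.range j, (q ^ (-(d + u)) - q ^ i * (q⁻¹ ^ u * q⁻¹ ^ n))) := by
    intro n
    rw [mul_assoc, ← nsmul_eq_mul, ← Finset.sum_const]
    refine Finset.sum_congr rfl fun v hv => ?_
    have hspan := (Finset.mem_filter.1 hv).2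
    have hs := finrank_residueDual_ker_eq (surjective_linearCombination_iff.2 hspan)
    have hcard : ∀ g ∈ linIndepTuples (relationModule R v) j,
        (1 / (Nat.card ((Fin n → R) ⧸ tupleKernel g) : ℝ)) ^ (n + u) =
          (1 / (Nat.card A : ℝ)) ^ (n + u) * (q⁻¹ ^ (n + u)) ^ j := by
      intro g hg
      rw [card_quotient_tupleKernel hg, card_quotient_relationModule hspan]
      rw [Nat.cast_mul, Nat.cast_pow, ← hqdef, ← pow_mul, mul_comm (n + u) j, pow_mul, ← mul_pow,
        one_div, one_div, mul_inv, inv_pow]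
    rw [Finset.sum_congr rfl hcard, Finset.sum_const, nsmul_eq_mul, card_linIndepTuples, pow_add,
      mul_comm, mul_assoc, mul_assoc]
    congr 2
    rw [← Finset.card_range j, ← Finset.prod_const, Finset.card_range, ← Finset.prod_mul_distrib]
    refine Finset.prod_congr rfl fun i _ => ?_
    -- The dimension `n - d` of the residue dual meets the exponent `-(n + u)`: the first term
    -- becomes `q^{-(d+u)}`, and the second decays like `q^{-n}`.
    rw [← hqdef, mul_sub, ← zpow_natCast q (Module.finrank _ _), hs]
    congr 1
    · rw [inv_pow, ← zpow_natCast q (n + u), ← zpow_neg, ← zpow_add₀ hq0]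
      congr 1
      push_cast
      ring
    · rw [pow_add]
      ring
  have hlim : Tendsto (fun n : ℕ =>
      ((Finset.univ.filter fun v : Fin n → A => Submodule.span R (Set.range v) = ⊤).card *
        (1 / (Nat.card A : ℝ)) ^ n) * ((1 / (Nat.card A : ℝ)) ^ u *
          ∏ i ∈ Finset.range j, (q ^ (-(d + u)) - q ^ i * (q⁻¹ ^ u * q⁻¹ ^ n)))) atTop
      (𝓝 ((1 / (Nat.card A : ℝ)) ^ u * (q ^ (-(d + u))) ^ j)) := by
    have h1 : Tendsto (fun n : ℕ => ∏ i ∈ Finset.range j,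
        (q ^ (-(d + u)) - q ^ i * (q⁻¹ ^ u * q⁻¹ ^ n))) atTop
        (𝓝 (∏ i ∈ Finset.range j, (q ^ (-(d + u)) - q ^ i * (q⁻¹ ^ u * 0)))) := by
      refine tendsto_finsetProd _ fun i _ => Tendsto.const_sub _ (Tendsto.const_mul _
        (Tendsto.const_mul _ ?_))
      exact tendsto_pow_atTop_nhds_zero_of_lt_one (by positivity) (inv_lt_one_of_one_lt₀ hq)
    have h2 := (tendsto_card_span_eq_top hm A).mul (h1.const_mul ((1 / (Nat.card A : ℝ)) ^ u))
    simpa using h2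
  have herr := tendsto_sum_tupleKernel_error hm u j A
  have hdiff : Tendsto (fun n : ℕ => tupleSum m A u j n -
      ((Finset.univ.filter fun v : Fin n → A => Submodule.span R (Set.range v) = ⊤).card *
        (1 / (Nat.card A : ℝ)) ^ n) * ((1 / (Nat.card A : ℝ)) ^ u *
          ∏ i ∈ Finset.range j, (q ^ (-(d + u)) - q ^ i * (q⁻¹ ^ u * q⁻¹ ^ n)))) atTop (𝓝 0) := by
    refine squeeze_zero_norm (fun n => ?_) herr
    rw [← hmain, tupleSum, ← Finset.sum_sub_distrib]
    refine (norm_sum_le _ _).trans (Finset.sum_le_sum fun v _ => ?_)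
    rw [← Finset.sum_sub_distrib]
    exact norm_sum_le _ _
  simpa using hdiff.add hlim

lemma sum_mul_mul_sub {ι : Type*} [Fintype ι] (W : ι → ℝ) (e : ℕ → ℝ) (b : ℕ → ι → ℝ) (d : ι → ℝ)
    (s c : ℝ) (J : Finset ℕ) :
    ∑ M, W M * (s * (∑ j ∈ J, e j * b j M - c * d M)) =
      s * (∑ j ∈ J, e j * ∑ M, W M * b j M - c * ∑ M, W M * d M) := by
  simp only [Finset.mul_sum]
  rw [Finset.sum_comm, ← Finset.sum_sub_distrib, Finset.mul_sum]
  refine Finset.sum_congr rfl fun M _ => ?_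
  have h : ∑ j ∈ J, e j * (W M * b j M) = W M * ∑ j ∈ J, e j * b j M := by
    rw [Finset.mul_sum]
    exact Finset.sum_congr rfl fun j _ => by ring
  rw [h]
  ring

lemma matrixProb_bonferroni (hm : ∀ x, 0 ≤ m x) (A : Type*) [AddCommGroup A] [Module R A]
    [Fintype A] (u J n : ℕ) :
    0 ≤ (-1) ^ J * (∑ j ∈ Finset.range (J + 1),
      eulerCoeff (Nat.card (IsLocalRing.ResidueField R)) j * tupleSum m A u j n -
        Nat.card (A ≃ₗ[R] A) * matrixProb m (fun M : Matrix (Fin n) (Fin (n + u)) R =>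
          Nonempty (MatrixCokernel M ≃ₗ[R] A))) := by
  classical
  have h : ∀ M : Matrix (Fin n) (Fin (n + u)) R, 0 ≤ (-1) ^ J *
      (∑ j ∈ Finset.range (J + 1), eulerCoeff (Nat.card (IsLocalRing.ResidueField R)) j *
        ∑ v : Fin n → A with Submodule.span R (Set.range v) = ⊤,
          ∑ g ∈ linIndepTuples (relationModule R v) j,
            (if LinearMap.range M.mulVecLin ≤ tupleKernel g then (1 : ℝ) else 0) -
        Nat.card (A ≃ₗ[R] A) * if Nonempty (MatrixCokernel M ≃ₗ[R] A) then 1 else 0) := by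
    intro M
    rw [card_aut_mul_ite]
    simp only [Finset.mul_sum]
    rw [Finset.sum_comm, ← Finset.sum_sub_distrib, Finset.mul_sum]
    refine Finset.sum_nonneg fun v _ => ?_
    have := bonferroni_submodule (relationModule R v) (LinearMap.range M.mulVecLin) J
    simp only [Finset.mul_sum] at this
    exact this
  have h2 : ∀ j, tupleSum m A u j n = ∑ M : Matrix (Fin n) (Fin (n + u)) R,
      (∏ i, ∏ j, m (M i j)) * ∑ v : Fin n → A with Submodule.span R (Set.range v) = ⊤,
        ∑ g ∈ linIndepTuples (relationModule R v) j,
          (if LinearMap.range M.mulVecLin ≤ tupleKernel g then (1 : ℝ) else 0) := by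
    intro j
    simp only [tupleSum, matrixProb, Finset.mul_sum]
    rw [Finset.sum_comm]
    refine Finset.sum_congr rfl fun v _ => Finset.sum_comm
  have h3 := sum_mul_mul_sub (ι := Matrix (Fin n) (Fin (n + u)) R) (fun M => ∏ i, ∏ j, m (M i j))
    (eulerCoeff (Nat.card (IsLocalRing.ResidueField R)))
    (fun j M => ∑ v : Fin n → A with Submodule.span R (Set.range v) = ⊤,
      ∑ g ∈ linIndepTuples (relationModule R v) j,
        (if LinearMap.range M.mulVecLin ≤ tupleKernel g then (1 : ℝ) else 0))
    (fun M => if Nonempty (MatrixCokernel M ≃ₗ[R] A) then 1 else 0)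
    ((-1) ^ J) (Nat.card (A ≃ₗ[R] A)) (Finset.range (J + 1))
  simp only [h2]
  rw [matrixProb]
  rw [← h3]
  exact Finset.sum_nonneg fun M _ => mul_nonneg
    (Finset.prod_nonneg fun i _ => Finset.prod_nonneg fun j _ => hm _) (h M)

/-- Odd truncations bound `a` from below and even ones from above; `n` goes to infinity for fixed
`J`, and `J` afterwards. -/
lemma tendsto_of_bonferroni {a : ℕ → ℝ} {T : ℕ → ℕ → ℝ} {τ : ℕ → ℝ} {l : ℝ}
    (hT : ∀ J, Tendsto (T J) atTop (𝓝 (τ J))) (hτ : Tendsto τ atTop (𝓝 l))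
    (h : ∀ J n, 0 ≤ (-1) ^ J * (T J n - a n)) : Tendsto a atTop (𝓝 l) := by
  refine tendsto_order.2 ⟨fun b hb => ?_, fun b hb => ?_⟩
  · obtain ⟨J₀, hJ₀⟩ := eventually_atTop.1 (hτ.eventually_const_lt hb)
    filter_upwards [(hT (2 * J₀ + 1)).eventually_const_lt (hJ₀ _ (by omega))] with n hn
    have := h (2 * J₀ + 1) n
    rw [pow_succ, pow_mul] at this
    norm_num at this
    linarith
  · obtain ⟨J₀, hJ₀⟩ := eventually_atTop.1 (hτ.eventually_lt_const hb)
    filter_upwards [(hT (2 * J₀)).eventually_lt_const (hJ₀ _ (by omega))] with n hn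
    have := h (2 * J₀) n
    rw [pow_mul] at this
    norm_num at this
    linarith

/-- Puts the factor in the form of Euler's product with `y = q^{-(d(A)+u)}`. -/
lemma sawinWoodFactor_eq (A : Type*) [AddCommGroup A] [Module R A] (u k : ℕ) :
    sawinWoodFactor R A u k = 1 - (Nat.card (IsLocalRing.ResidueField R) : ℝ) ^
      (-(presentationDefect R A + u)) *
        ((Nat.card (IsLocalRing.ResidueField R) : ℝ) ^ (k + 1))⁻¹ := by
  have hq0 : (Nat.card (IsLocalRing.ResidueField R) : ℝ) ≠ 0 := by
    linarith [one_lt_card_residueField R]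
  rw [sawinWoodFactor, ← zpow_natCast, ← zpow_neg, ← zpow_add₀ hq0]
  congr 2
  push_cast
  ring

theorem multipliable_sawinWoodFactor (A : Type*) [AddCommGroup A] [Module R A] (u : ℕ) :
    Multipliable (sawinWoodFactor R A u) := by
  rw [funext (sawinWoodFactor_eq A u)]
  exact multipliable_eulerProduct (one_lt_card_residueField R) _

/-- The distribution of the cokernel converges, for any nondegenerate weights of the entries. -/
theorem tendsto_matrixProb_cokernel (hm : IsNondegenerateWeight m) (u : ℕ)
    (A : Type*) [AddCommGroup A] [Module R A] [Finite A] :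
    Tendsto (fun n => matrixProb m (fun M : Matrix (Fin n) (Fin (n + u)) R =>
      Nonempty (MatrixCokernel M ≃ₗ[R] A))) atTop (𝓝 (sawinWoodValue R A u)) := by
  have := Fintype.ofFinite A
  have hq := one_lt_card_residueField R
  have hAut : (Nat.card (A ≃ₗ[R] A) : ℝ) ≠ 0 := by
    have : Finite (A ≃ₗ[R] A) := DFunLike.finite _
    exact Nat.cast_ne_zero.2 Nat.card_pos.ne'
  have hlim := tendsto_of_bonferroni
    (fun J => tendsto_finsetSum (Finset.range (J + 1)) fun j _ =>
      (tendsto_tupleSum hm u j A).const_mul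
        (eulerCoeff (Nat.card (IsLocalRing.ResidueField R)) j))
    (l := (1 / (Nat.card A : ℝ)) ^ u * ∏' k : ℕ, sawinWoodFactor R A u k) ?_
    (fun J n => matrixProb_bonferroni hm.nonneg A u J n)
  · have h := hlim.const_mul (Nat.card (A ≃ₗ[R] A) : ℝ)⁻¹
    have hval : (Nat.card (A ≃ₗ[R] A) : ℝ)⁻¹ * ((1 / (Nat.card A : ℝ)) ^ u *
        ∏' k : ℕ, sawinWoodFactor R A u k) = sawinWoodValue R A u := by
      rw [sawinWoodValue, one_div, one_div, inv_pow, mul_inv]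
      ring
    rw [hval] at h
    refine h.congr fun n => ?_
    rw [inv_mul_cancel_left₀ hAut]
  · have h := ((tendsto_sum_eulerCoeff hq (y := (Nat.card (IsLocalRing.ResidueField R) : ℝ) ^
      (-(presentationDefect R A + u))) (by positivity)).comp (tendsto_add_atTop_nat 1)).const_mul
        ((1 / (Nat.card A : ℝ)) ^ u)
    simp only [sawinWoodFactor_eq]
    refine h.congr fun J => ?_
    rw [Function.comp, Finset.mul_sum]
    exact Finset.sum_congr rfl fun j _ => by ring

end TupleSums

/-! ### The theorem for random matrices -/

theorem IsIIDMatrix.tendsto_cokernel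
    {R : Type*} [CommRing R] [IsLocalRing R] [Finite R]
    [MeasurableSpace R] [MeasurableSingletonClass R] (u : ℕ)
    {μ : Measure R} [IsProbabilityMeasure μ] (hμ : IsNondegenerateLaw μ)
    {Ω : ℕ → Type*} [∀ n, MeasurableSpace (Ω n)]
    {P : ∀ n, Measure (Ω n)} [∀ n, IsProbabilityMeasure (P n)]
    {M : ∀ n, Ω n → Matrix (Fin n) (Fin (n + u)) R} (hM : ∀ n, IsIIDMatrix (M n) μ (P n))
    (A : Type*) [AddCommGroup A] [Module R A] [Finite A] :
    Tendsto (fun n => (P n).real {ω | Nonempty (MatrixCokernel (M n ω) ≃ₗ[R] A)}) atTop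
      (𝓝 (sawinWoodValue R A u)) := by
  have := Fintype.ofFinite R
  refine (tendsto_matrixProb_cokernel hμ.isNondegenerateWeight u A).congr fun n => ?_
  exact ((hM n).measureReal_eq fun M => Nonempty (MatrixCokernel M ≃ₗ[R] A)).symm

theorem mainTheorem8
    {R : Type*} [CommRing R] [IsLocalRing R] [Finite R]
    [MeasurableSpace R] [MeasurableSingletonClass R]
    (u : ℕ)
    -- the law of the entries
    (μ : Measure R) [IsProbabilityMeasure μ] (hμ : IsNondegenerateLaw μ)
    -- the random matrices with i.i.d. entries of law `μ`
    {Ω : ℕ → Type*} [∀ n, MeasurableSpace (Ω n)]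
    (P : ∀ n, Measure (Ω n)) [∀ n, IsProbabilityMeasure (P n)]
    (M : ∀ n, Ω n → Matrix (Fin n) (Fin (n + u)) R)
    (hM : ∀ n, IsIIDMatrix (M n) μ (P n))
    -- the random matrices with i.i.d. uniform entries
    {Ω' : ℕ → Type*} [∀ n, MeasurableSpace (Ω' n)]
    (P' : ∀ n, Measure (Ω' n)) [∀ n, IsProbabilityMeasure (P' n)]
    (U : ∀ n, Ω' n → Matrix (Fin n) (Fin (n + u)) R)
    (hU : ∀ n, IsIIDMatrix (U n) (uniformOn (Set.univ : Set R)) (P' n))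
    -- the target module
    {A : Type*} [AddCommGroup A] [Module R A] [Finite A] :
    Multipliable (sawinWoodFactor R A u) ∧
    Tendsto (fun n => (P n).real {ω | Nonempty (MatrixCokernel (M n ω) ≃ₗ[R] A)}) atTop
      (𝓝 (sawinWoodValue R A u)) ∧
    Tendsto (fun n => (P' n).real {ω | Nonempty (MatrixCokernel (U n ω) ≃ₗ[R] A)}) atTop
      (𝓝 (sawinWoodValue R A u)) := by
  have := Fintype.ofFinite R
  have : IsProbabilityMeasure (uniformOn (Set.univ : Set R)) := isProbabilityMeasure_uniformOn_univ
  exact ⟨multipliable_sawinWoodFactor A u, IsIIDMatrix.tendsto_cokernel u hμ hM A,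
    IsIIDMatrix.tendsto_cokernel u isNondegenerateLaw_uniformOn_univ hU A⟩
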